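/- For $\ell\in\mathbb N=\{0,1,2,\dots\}$, a binary sequence of length $\ell$ is a doubly infinite sequence $f=(f_j)_{j\in\mathbb Z}$ of complex numbers with $f_j\in\{1,-1\}$ for $0\le j<\ell$ and $f_j=0$ for all other $j$. For $s\in\mathbb Z$ let $C_f(s)=\sum_{j\in\mathbb Z} f_{j+s}\overline{f_j}$, and put \[ \mathrm{ssac}(f)=\sum_{s\in\mathbb Z}|C_f(s)|^2,\qquad \mathrm{ADF}(f)=\frac{\sum_{s\in\mathbb Z,\,s\neq 0}|C_f(s)|^2}{C_f(0)^2}\quad(\text{for } f\ne 0). \] Let $\mathbb E^\ell$ denote the expected value when $f$ is uniformly distributed over the $2^\ell$ binary sequences of length $\ell$, and for a real-valued function $v$ of $f$ write $\mu_p^\ell v=\mathbb E^\ell\big(v(f)-\mathbb E^\ell v(f)\big)^p$ for the $p$th central moment and $\tilde\mu_p^\ell v=\mu_p^\ell v/(\mu_2^\ell v)^{p/2}$ for the $p$th standardized moment. (1) For every $\ell\in\mathbb N$, \[ \mu_3^\ell\,\mathrm{ssac}=\begin{cases} 160\ell^4-1296\ell^3+3296\ell^2-2496\ell & \text{if }\ell\equiv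 0\pmod 4,\\ 160\ell^4-1296\ell^3+3296\ell^2-2736\ell+576 & \text{if }\ell\equiv \pm1\pmod 4,\\ 160\ell^4-1296\ell^3+3296\ell^2-2496\ell-384 & \text{if }\ell\equiv 2\pmod 4. \end{cases} \] (2) For every integer $\ell\ge 1$, \[ \mu_3^\ell\,\mathrm{ADF}=\begin{cases} \dfrac{160\ell^4-1296\ell^3+3296\ell^2-2496\ell}{\ell^6} & \text{if }\ell\equiv 0\pmod 4,\\[6pt] \dfrac{160\ell^4-1296\ell^3+3296\ell^2-2736\ell+576}{\ell^6} & \text{if }\ell\equiv \pm1\pmod 4,\\[6pt] \dfrac{160\ell^4-1296\ell^3+3296\ell^2-2496\ell-384}{\ell^6} & \text{if }\ell\equiv 2\pmod 4. \end{cases} \] (3) For every integer $\ell\ge 1$, each of the variances $\mu_2^\ell\,\mathrm{ADF}$ and $\mu_2^\ell\,\mathrm{ssac}$ is positive if and only if $\ell\ge 3$, and \[ \tilde\mu_3^\ell\,\mathrm{ADF}=\tilde\mu_3^\ell\,\mathrm{ssac}=\begin{cases} \dfrac{6\sqrt3\,(10\ell^4-81\ell^3+206\ell^2-156\ell)}{(4\ell^3-15\ell^2+14\ell)^{3/2}}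 & \text{if }\ell\equiv 0\pmod 4,\\[8pt] \dfrac{6\sqrt3\,(10\ell^4-81\ell^3+206\ell^2-171\ell+36)}{(4\ell^3-15\ell^2+14\ell-3)^{3/2}} & \text{if }\ell\equiv \pm1\pmod 4,\\[8pt] \dfrac{6\sqrt3\,(10\ell^4-81\ell^3+206\ell^2-156\ell-24)}{(4\ell^3-15\ell^2+14\ell)^{3/2}} & \text{if }\ell\equiv 2\pmod 4, \end{cases} \] where for $\ell\in\{1,2\}$ all these quotients have the form $0/0$, which is read as $0$. -/

import Mathlib

namespace DemeritFactor

/-- The aperiodic autocorrelation of `f` at shift `s`, `C_f(s) = ∑_{j ∈ ℤ} f_{j+s} * conj f_j`,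
for a doubly infinite complex sequence `f` with finitely many nonzero terms. -/
noncomputable def autocorr (f : ℤ → ℂ) (s : ℤ) : ℂ :=
  ∑ᶠ j : ℤ, f (j + s) * starRingEnd ℂ (f j)

/-- The sum over all shifts of the squared magnitudes of the autocorrelation values. -/
noncomputable def ssac (f : ℤ → ℂ) : ℝ :=
  ∑ᶠ s : ℤ, ‖autocorr f s‖ ^ 2

/-- The autocorrelation demerit factor of a nonzero sequence. The value `C_f(0)` is the squared
Euclidean norm of `f`, a nonnegative real number, so it equals its own absolute value. -/
noncomputable def ADF (f : ℤ → ℂ) : ℝ :=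
  (∑ᶠ (s : ℤ) (_ : s ≠ 0), ‖autocorr f s‖ ^ 2) / ‖autocorr f 0‖ ^ 2

/-- The binary sequences of length `ℓ`: the entries at positions `0, …, ℓ - 1` are `1` or `-1`,
all other entries are `0`. -/
def binarySeqs (ℓ : ℕ) : Set (ℤ → ℂ) :=
  {f | ∀ j : ℤ, (0 ≤ j ∧ j < ℓ → f j = 1 ∨ f j = -1) ∧ (¬ (0 ≤ j ∧ j < ℓ) → f j = 0)}

theorem binarySeqs_finite (ℓ : ℕ) : (binarySeqs ℓ).Finite := by
  have key : Set.InjOn (fun (f : ℤ → ℂ) (i : Fin ℓ) => f (i : ℕ)) (binarySeqs ℓ) := by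
    intro f hf g hg h
    funext j
    by_cases hj : 0 ≤ j ∧ j < ℓ
    · have h1 := congrFun h ⟨j.toNat, by omega⟩
      have h2 : ((j.toNat : ℕ) : ℤ) = j := Int.toNat_of_nonneg hj.1
      simpa [h2] using h1
    · rw [(hf j).2 hj, (hg j).2 hj]
  refine Set.Finite.of_finite_image ?_ key
  refine (Set.Finite.pi' (t := fun _ : Fin ℓ => ({1, -1} : Set ℂ)) fun _ => by simp).subset ?_
  rintro _ ⟨f, hf, rfl⟩ i
  exact (hf (i : ℕ)).1 ⟨by omega, by have := i.2; omega⟩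

/-- The expected value of `v f`, for `f` uniformly distributed over the binary sequences of
length `ℓ`. -/
noncomputable def expectation (ℓ : ℕ) (v : (ℤ → ℂ) → ℝ) : ℝ :=
  (∑ f ∈ (binarySeqs_finite ℓ).toFinset, v f) / ((binarySeqs_finite ℓ).toFinset.card : ℝ)

/-- The `p`th central moment of `v f`, for `f` uniformly distributed over the binary sequences
of length `ℓ`. -/
noncomputable def centralMoment (p ℓ : ℕ) (v : (ℤ → ℂ) → ℝ) : ℝ :=
  expectation ℓ fun f => (v f - expectation ℓ v) ^ p

/-- The `p`th standardized moment (for `p = 3`, the skewness) of `v f`, for `f` uniformly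
distributed over the binary sequences of length `ℓ`. -/
noncomputable def standardizedMoment (p ℓ : ℕ) (v : (ℤ → ℂ) → ℝ) : ℝ :=
  centralMoment p ℓ v / centralMoment 2 ℓ v ^ ((p : ℝ) / 2)

end DemeritFactor

namespace DemeritFactor

open Finset

/-! Expand `ssac` in Walsh characters. Squaring an autocorrelation gives products of `f` over
parallelograms `a, a + u, a + v, a + u + v`. Those with `u = v` collapse to a pair of positions of
equal parity, because the middle entry is squared; those with `u ≠ v` come in twos, by exchanging
`u` and `v`. Hence (`ssac_eq`) `ssac` is a constant plus `4 * (P + 2 * Q)`, where `P` and `Q` are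
the sums of the characters over `evenPairs` and `quads`.

A nonempty character has mean zero, and characters multiply by symmetric difference. So the variance
is found by counting the two families, and the expectation of `(P + 2 * Q) ^ 3` counts ordered
triples of index sets, each the symmetric difference of the other two, with weights 1, 6, 12, 8
according to the types `PPP`, `PPQ`, `QQP`, `QQQ`.

Each type is a lattice-point count. `PPP` consists of triangles inside one parity class. `QQP` is
counted through the common three points of the two quads: any two completions of the same triple to
a quad differ by an even number. In `PPQ` and `QQQ` a quad splits into two disjoint pairs with the
same sum or the same difference (`matched_quads_iff`). For `QQQ` three pairs must be related in this
way, and the relations are all of one kind, so the count is one of equal-sum triples plus one of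
equal-difference triples.

The counts become sums over arithmetic progressions of steps 1 to 4. The step-3 sums cancel, the
step-2 sums produce the dependence on parity, and a single step-4 sum, coming from `PPQ`, separates
the residues 0 and 2 modulo 4. The results for `ADF` follow since `ADF` is an affine function of
`ssac` at fixed length. -/

/-! ### Walsh characters and their expectations -/

theorem binarySeqs_apply_eq {ℓ : ℕ} {f : ℤ → ℂ} (hf : f ∈ binarySeqs ℓ) (j : ℤ) :
    f j = ((f j).re : ℂ) := by
  by_cases hj : 0 ≤ j ∧ j < ℓ
  · rcases (hf j).1 hj with h | h <;> simp [h]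
  · simp [(hf j).2 hj]

theorem binarySeqs_re_mul_self {ℓ : ℕ} {f : ℤ → ℂ} (hf : f ∈ binarySeqs ℓ) {j : ℕ}
    (hj : j < ℓ) : (f j).re * (f j).re = 1 := by
  rcases (hf j).1 ⟨by omega, by omega⟩ with h | h <;> simp [h]

/-- The Walsh character of the sequence `f` indexed by the set `S` of positions. -/
noncomputable def chi (S : Finset ℕ) (f : ℤ → ℂ) : ℝ := ∏ j ∈ S, (f j).re

/-- The entries over the common part `A ∩ B` are squares of signs, so they cancel; what remains is
the product over the symmetric difference. -/
theorem chi_mul_chi {ℓ : ℕ} {f : ℤ → ℂ} (hf : f ∈ binarySeqs ℓ) {A B : Finset ℕ}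
    (hA : A ⊆ range ℓ) : chi A f * chi B f = chi (symmDiff A B) f := by
  have h1 : chi A f = chi (A \ B) f * chi (A ∩ B) f := by
    unfold chi
    rw [← prod_union (disjoint_sdiff_inter A B), sdiff_union_inter]
  have h2 : chi B f = chi (B \ A) f * chi (A ∩ B) f := by
    unfold chi
    rw [inter_comm, ← prod_union (disjoint_sdiff_inter B A), sdiff_union_inter]
  have h3 : chi (symmDiff A B) f = chi (A \ B) f * chi (B \ A) f := by
    unfold chi
    rw [symmDiff_def, sup_eq_union, prod_union disjoint_sdiff_sdiff]
  have h4 : chi (A ∩ B) f * chi (A ∩ B) f = 1 := by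
    unfold chi
    rw [← prod_mul_distrib]
    refine prod_eq_one fun j hj => ?_
    exact binarySeqs_re_mul_self hf (mem_range.1 (hA (mem_inter.1 hj).1))
  rw [h1, h2, h3]
  linear_combination (chi (A \ B) f * chi (B \ A) f) * h4

theorem binarySeqs_toFinset_card_pos (ℓ : ℕ) :
    0 < ((binarySeqs_finite ℓ).toFinset.card : ℝ) := by
  rw [Nat.cast_pos, card_pos]
  refine ⟨fun j => if 0 ≤ j ∧ j < ℓ then 1 else 0, ?_⟩
  rw [Set.Finite.mem_toFinset]
  intro j
  constructor
  · intro h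
    left
    simp [h]
  · intro h
    simp only [if_neg h]

theorem expectation_congr {ℓ : ℕ} {v w : (ℤ → ℂ) → ℝ} (h : ∀ f ∈ binarySeqs ℓ, v f = w f) :
    expectation ℓ v = expectation ℓ w := by
  unfold expectation
  rw [sum_congr rfl fun f hf => h f ((Set.Finite.mem_toFinset _).1 hf)]

theorem expectation_const (ℓ : ℕ) (c : ℝ) : expectation ℓ (fun _ => c) = c := by
  unfold expectation
  rw [sum_const, nsmul_eq_mul, mul_div_cancel_left₀ _ (binarySeqs_toFinset_card_pos ℓ).ne']

theorem expectation_add (ℓ : ℕ) (v w : (ℤ → ℂ) → ℝ) :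
    expectation ℓ (fun f => v f + w f) = expectation ℓ v + expectation ℓ w := by
  unfold expectation
  rw [sum_add_distrib, add_div]

theorem expectation_const_mul (ℓ : ℕ) (c : ℝ) (v : (ℤ → ℂ) → ℝ) :
    expectation ℓ (fun f => c * v f) = c * expectation ℓ v := by
  unfold expectation
  rw [← mul_sum, mul_div_assoc]

theorem expectation_sum {ι : Type*} (ℓ : ℕ) (s : Finset ι) (v : ι → (ℤ → ℂ) → ℝ) :
    expectation ℓ (fun f => ∑ i ∈ s, v i f) = ∑ i ∈ s, expectation ℓ (v i) := by
  unfold expectation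
  rw [sum_comm, sum_div]

/-- Negating the entry at a single position. -/
def flip (i : ℕ) (f : ℤ → ℂ) : ℤ → ℂ := fun j => if j = i then -f j else f j

theorem flip_mem {ℓ : ℕ} {f : ℤ → ℂ} (hf : f ∈ binarySeqs ℓ) (i : ℕ) :
    flip i f ∈ binarySeqs ℓ := by
  intro j
  unfold flip
  refine ⟨fun hj => ?_, fun hj => ?_⟩
  · split_ifs
    · rcases (hf j).1 hj with h | h <;> simp [h]
    · exact (hf j).1 hj
  · simp [(hf j).2 hj]

theorem chi_flip {S : Finset ℕ} {i : ℕ} (hi : i ∈ S) (f : ℤ → ℂ) :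
    chi S (flip i f) = -chi S f := by
  unfold chi
  rw [← mul_prod_erase S _ hi, ← mul_prod_erase S (fun j => (f j).re) hi]
  have : ∏ x ∈ S.erase i, (flip i f x).re = ∏ x ∈ S.erase i, (f x).re := by
    refine prod_congr rfl fun x hx => ?_
    have : (x : ℤ) ≠ i := by exact_mod_cast (mem_erase.1 hx).1
    simp [flip, this]
  rw [this]
  simp [flip]

/-- Flipping the sign at one position of `S` is an involution of the sample space that negates `chi
S`, so a nonempty `S` gives mean zero. -/
theorem expectation_chi (ℓ : ℕ) (S : Finset ℕ) :
    expectation ℓ (chi S) = if S = ∅ then 1 else 0 := by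
  split_ifs with h
  · subst h
    exact (expectation_congr fun f _ => by simp [chi]).trans (expectation_const ℓ 1)
  · obtain ⟨i, hi⟩ := nonempty_iff_ne_empty.2 h
    have hsum : ∑ f ∈ (binarySeqs_finite ℓ).toFinset, chi S f
        = ∑ f ∈ (binarySeqs_finite ℓ).toFinset, -chi S f := by
      have hmem : ∀ f ∈ (binarySeqs_finite ℓ).toFinset,
          flip i f ∈ (binarySeqs_finite ℓ).toFinset := by
        intro f hf
        rw [Set.Finite.mem_toFinset] at hf ⊢
        exact flip_mem hf i
      have hinv : ∀ f : ℤ → ℂ, flip i (flip i f) = f := by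
        intro f
        funext j
        unfold flip
        split_ifs <;> simp
      refine sum_bij' (fun f _ => flip i f) (fun f _ => flip i f) hmem hmem
        (fun f _ => hinv f) (fun f _ => hinv f) fun f _ => ?_
      rw [chi_flip hi, neg_neg]
    rw [sum_neg_distrib] at hsum
    have : ∑ f ∈ (binarySeqs_finite ℓ).toFinset, chi S f = 0 := by linarith
    unfold expectation
    rw [this, zero_div]

/-- Two families of Walsh characters are paired by counting their common index sets. -/
theorem expectation_sum_chi_mul_sum_chi {ℓ : ℕ} (F G : Finset (Finset ℕ))
    (hF : ∀ A ∈ F, A ⊆ range ℓ) :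
    expectation ℓ (fun f => (∑ A ∈ F, chi A f) * ∑ B ∈ G, chi B f) = ((F ∩ G).card : ℝ) := by
  have h : ∀ f ∈ binarySeqs ℓ, (∑ A ∈ F, chi A f) * ∑ B ∈ G, chi B f
      = ∑ A ∈ F, ∑ B ∈ G, chi (symmDiff A B) f := by
    intro f hf
    rw [sum_mul_sum]
    exact sum_congr rfl fun A hA => sum_congr rfl fun B _ => chi_mul_chi hf (hF A hA)
  rw [expectation_congr h, expectation_sum]
  simp_rw [expectation_sum, expectation_chi]
  rw [← filter_mem_eq_inter, card_filter, Nat.cast_sum]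
  refine sum_congr rfl fun A _ => ?_
  have h : ∀ B : Finset ℕ, symmDiff A B = ∅ ↔ A = B := fun B => symmDiff_eq_bot
  simp [h]

/-- Ordered pairs of members of `F` and `G` whose symmetric difference lies in `H`. -/
def symmDiffPairs (F G H : Finset (Finset ℕ)) : Finset (Finset ℕ × Finset ℕ) :=
  (F ×ˢ G).filter fun p => symmDiff p.1 p.2 ∈ H

/-- A product of three characters has mean 1 exactly when the third index set is the symmetric
difference of the first two, so each pair `(A, B)` admits at most one `C`. -/
theorem expectation_sum_chi_mul_sum_chi_mul_sum_chi {ℓ : ℕ} (F G H : Finset (Finset ℕ))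
    (hF : ∀ A ∈ F, A ⊆ range ℓ) (hG : ∀ A ∈ G, A ⊆ range ℓ) :
    expectation ℓ (fun f => (∑ A ∈ F, chi A f) * (∑ B ∈ G, chi B f) * ∑ C ∈ H, chi C f)
      = ((symmDiffPairs F G H).card : ℝ) := by
  have h : ∀ f ∈ binarySeqs ℓ, (∑ A ∈ F, chi A f) * (∑ B ∈ G, chi B f) * ∑ C ∈ H, chi C f
      = ∑ p ∈ F ×ˢ G, ∑ C ∈ H, chi (symmDiff (symmDiff p.1 p.2) C) f := by
    intro f hf
    rw [sum_mul_sum, ← sum_product', sum_mul_sum]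
    refine sum_congr rfl fun p hp => sum_congr rfl fun C _ => ?_
    rw [mem_product] at hp
    rw [chi_mul_chi hf (hF _ hp.1), chi_mul_chi hf]
    intro x hx
    rcases mem_symmDiff.1 hx with h | h
    · exact hF _ hp.1 h.1
    · exact hG _ hp.2 h.1
  rw [expectation_congr h, expectation_sum]
  simp_rw [expectation_sum, expectation_chi]
  rw [symmDiffPairs, card_filter, Nat.cast_sum]
  refine sum_congr rfl fun p _ => ?_
  have h : ∀ C : Finset ℕ, symmDiff (symmDiff p.1 p.2) C = ∅ ↔ symmDiff p.1 p.2 = C :=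
    fun C => symmDiff_eq_bot
  simp [h]

/-! ### Autocorrelations as finite real sums -/

theorem autocorr_natCast {ℓ : ℕ} {f : ℤ → ℂ} (hf : f ∈ binarySeqs ℓ) (s : ℕ) :
    autocorr f s = ((∑ a ∈ range (ℓ - s), (f a).re * (f (a + s : ℕ)).re : ℝ) : ℂ) := by
  unfold autocorr
  rw [finsum_eq_sum_of_support_subset (s := (range (ℓ - s)).map Nat.castEmbedding)]
  · rw [sum_map, Complex.ofReal_sum]
    refine sum_congr rfl fun a _ => ?_
    rw [Nat.castEmbedding_apply, Complex.ofReal_mul, ← binarySeqs_apply_eq hf,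
      ← binarySeqs_apply_eq hf, binarySeqs_apply_eq hf a, Complex.conj_ofReal, mul_comm]
    push_cast
    rfl
  · intro j hj
    rw [Function.mem_support] at hj
    have h1 : 0 ≤ j ∧ j < ℓ := by
      by_contra h
      exact hj (by simp [(hf j).2 h])
    have h2 : 0 ≤ j + s ∧ j + s < ℓ := by
      by_contra h
      exact hj (by simp [(hf (j + s)).2 h])
    simp only [coe_map, Set.mem_image, mem_coe, mem_range, Nat.castEmbedding_apply]
    exact ⟨j.toNat, by omega, by omega⟩

theorem norm_autocorr_neg (f : ℤ → ℂ) (s : ℤ) : ‖autocorr f (-s)‖ = ‖autocorr f s‖ := by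
  have h : autocorr f (-s) = starRingEnd ℂ (autocorr f s) := by
    unfold autocorr
    refine (finsum_comp_equiv (Equiv.addRight s)).symm.trans ?_
    -- Injectivity of conjugation lets it pass through the `finsum` without assuming finite support.
    refine Eq.trans (finsum_congr fun j => ?_) (AddMonoidHom.map_finsum_of_injective
      (starRingEnd ℂ).toAddMonoidHom star_injective _).symm
    simp [mul_comm]
  rw [h, RCLike.norm_conj]

theorem autocorr_zero {ℓ : ℕ} {f : ℤ → ℂ} (hf : f ∈ binarySeqs ℓ) : autocorr f 0 = ℓ := by
  have h := autocorr_natCast hf 0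
  rw [Nat.cast_zero] at h
  rw [h, sum_congr rfl (g := fun _ => (1 : ℝ))]
  · simp
  · exact fun a ha => binarySeqs_re_mul_self hf (by simpa using ha)

theorem norm_autocorr_eq_zero {ℓ : ℕ} {f : ℤ → ℂ} (hf : f ∈ binarySeqs ℓ) {s : ℤ}
    (hs : ℓ ≤ s.natAbs) : ‖autocorr f s‖ = 0 := by
  have h : autocorr f s.natAbs = 0 := by
    rw [autocorr_natCast hf, Nat.sub_eq_zero_of_le hs]
    simp
  rcases Int.natAbs_eq s with h' | h'
  · rw [h', h, norm_zero]
  · rw [h', norm_autocorr_neg, h, norm_zero]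

theorem support_norm_autocorr_sq_subset {ℓ : ℕ} {f : ℤ → ℂ} (hf : f ∈ binarySeqs ℓ) :
    (Function.support fun s : ℤ => ‖autocorr f s‖ ^ 2) ⊆ Set.Ioo (-ℓ : ℤ) ℓ := by
  intro s hs
  rw [Function.mem_support] at hs
  have h : ¬ ℓ ≤ s.natAbs := fun h => hs (by rw [norm_autocorr_eq_zero hf h]; simp)
  rw [Set.mem_Ioo]
  omega

theorem finsum_int_eq_of_even {g : ℤ → ℝ} {ℓ : ℕ} (heven : ∀ s, g (-s) = g s)
    (hsupp : Function.support g ⊆ Set.Ioo (-ℓ : ℤ) ℓ) :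
    ∑ᶠ s, g s = g 0 + 2 * ∑ s ∈ range ℓ, g (s + 1 : ℕ) := by
  have hdisj : Disjoint ((range ℓ).image fun s : ℕ => (s : ℤ))
      ((range ℓ).image fun s : ℕ => -((s + 1 : ℕ) : ℤ)) := by
    rw [disjoint_left]
    intro z hz hz'
    simp only [mem_image, mem_range] at hz hz'
    obtain ⟨a, -, rfl⟩ := hz
    obtain ⟨b, -, hb⟩ := hz'
    omega
  rw [finsum_eq_sum_of_support_subset (s := (range ℓ).image (fun s : ℕ => (s : ℤ)) ∪
    (range ℓ).image fun s : ℕ => -((s + 1 : ℕ) : ℤ)), sum_union hdisj, sum_image, sum_image]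
  -- The nonnegative half runs over `0, …, ℓ - 1` and the negative half over `1, …, ℓ` in absolute
  -- value. As `g ℓ = 0`, they differ only by `g 0`.
  · have h1 := sum_range_succ (fun s : ℕ => g s) ℓ
    rw [sum_range_succ'] at h1
    have h2 : g ℓ = 0 := by
      by_contra h
      exact absurd (hsupp h).2 (lt_irrefl _)
    simp only [heven]
    simp only [Nat.cast_zero, h2, add_zero] at h1
    rw [← h1]
    ring
  · intro a _ b _ h
    simp only at h
    omega
  · intro a _ b _ h
    simpa using h
  · intro s hs
    have h := hsupp hs
    rw [Set.mem_Ioo] at h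
    simp only [coe_union, coe_image, Set.mem_union, Set.mem_image, mem_coe, mem_range]
    rcases le_or_gt 0 s with h0 | h0
    · exact Or.inl ⟨s.toNat, by omega, by omega⟩
    · exact Or.inr ⟨(-s - 1).toNat, by omega, by omega⟩

theorem ssac_eq_sum_range {ℓ : ℕ} {f : ℤ → ℂ} (hf : f ∈ binarySeqs ℓ) :
    ssac f = (ℓ : ℝ) ^ 2 + 2 * ∑ s ∈ range ℓ,
      (∑ a ∈ range (ℓ - (s + 1)), (f a).re * (f (a + (s + 1) : ℕ)).re) ^ 2 := by
  unfold ssac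
  rw [finsum_int_eq_of_even (fun s => by rw [norm_autocorr_neg])
    (support_norm_autocorr_sq_subset hf), autocorr_zero hf, Complex.norm_natCast]
  congr 2
  refine sum_congr rfl fun s _ => ?_
  rw [autocorr_natCast hf, Complex.norm_real, Real.norm_eq_abs, sq_abs]

theorem ADF_eq {ℓ : ℕ} {f : ℤ → ℂ} (hf : f ∈ binarySeqs ℓ) :
    ADF f = (ssac f - (ℓ : ℝ) ^ 2) / (ℓ : ℝ) ^ 2 := by
  have h := add_finsum_cond_ne (f := fun s : ℤ => ‖autocorr f s‖ ^ 2) 0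
    ((Set.finite_Ioo _ _).subset (support_norm_autocorr_sq_subset hf))
  rw [autocorr_zero hf, Complex.norm_natCast] at h
  unfold ADF ssac
  rw [autocorr_zero hf, Complex.norm_natCast, ← h, add_sub_cancel_left]

/-! ### Walsh expansion of `ssac` over pairs and quads -/

theorem sum_range_sq (y : ℕ → ℝ) (n : ℕ) :
    (∑ a ∈ range n, y a) ^ 2
      = ∑ a ∈ range n, y a ^ 2 + 2 * ∑ b ∈ range n, ∑ a ∈ range b, y a * y b := by
  induction n with
  | zero => simp
  | succ n ih =>
    rw [sum_range_succ, sum_range_succ, sum_range_succ, ← sum_mul]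
    linear_combination ih

/-- Triples `(a, u, v)` with positive `u`, `v` and `a + u + v < ℓ`. -/
def triples (ℓ : ℕ) : Finset (ℕ × ℕ × ℕ) :=
  (range ℓ ×ˢ range ℓ ×ˢ range ℓ).filter fun t => 0 < t.2.1 ∧ 0 < t.2.2 ∧ t.1 + t.2.1 + t.2.2 < ℓ

theorem mem_triples {ℓ a u v : ℕ} : (a, u, v) ∈ triples ℓ ↔ 0 < u ∧ 0 < v ∧ a + u + v < ℓ := by
  simp only [triples, mem_filter, mem_product, mem_range]
  omega

/-- The parallelogram `{a, a + u, a + v, a + u + v}`. -/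
def parallelogram (t : ℕ × ℕ × ℕ) : Finset ℕ :=
  {t.1, t.1 + t.2.1, t.1 + t.2.2, t.1 + t.2.1 + t.2.2}

/-- The sets of four distinct numbers below `ℓ` whose extremes have the same sum as the two
middle ones. -/
def quads (ℓ : ℕ) : Finset (Finset ℕ) :=
  ((triples ℓ).filter fun t => t.2.1 < t.2.2).image parallelogram

/-- The sets of two distinct numbers below `ℓ` of the same parity. -/
def evenPairs (ℓ : ℕ) : Finset (Finset ℕ) :=
  ((triples ℓ).filter fun t => t.2.1 = t.2.2).image fun t => {t.1, t.1 + t.2.1 + t.2.2}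

theorem mem_quads {ℓ : ℕ} {q : Finset ℕ} : q ∈ quads ℓ ↔
    ∃ a u v, 0 < u ∧ u < v ∧ a + u + v < ℓ ∧ q = {a, a + u, a + v, a + u + v} := by
  simp only [quads, mem_image, mem_filter, Prod.exists, mem_triples, parallelogram]
  constructor
  · rintro ⟨a, u, v, h, rfl⟩
    exact ⟨a, u, v, by omega, by omega, by omega, rfl⟩
  · rintro ⟨a, u, v, h1, h2, h3, rfl⟩
    exact ⟨a, u, v, by omega, rfl⟩

theorem mem_evenPairs {ℓ : ℕ} {A : Finset ℕ} : A ∈ evenPairs ℓ ↔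
    ∃ a d, 0 < d ∧ a + 2 * d < ℓ ∧ A = {a, a + 2 * d} := by
  simp only [evenPairs, mem_image, mem_filter, Prod.exists, mem_triples]
  constructor
  · rintro ⟨a, u, v, h, rfl⟩
    refine ⟨a, u, by omega, by omega, ?_⟩
    rw [← h.2, two_mul, add_assoc]
  · rintro ⟨a, u, h1, h2, rfl⟩
    exact ⟨a, u, u, by omega, by rw [two_mul, add_assoc]⟩

theorem quads_subset_range {ℓ : ℕ} : ∀ q ∈ quads ℓ, q ⊆ range ℓ := by
  intro q hq
  obtain ⟨a, u, v, h1, h2, h3, rfl⟩ := mem_quads.1 hq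
  intro x hx
  simp only [mem_insert, mem_singleton] at hx
  rw [mem_range]
  omega

theorem evenPairs_subset_range {ℓ : ℕ} : ∀ A ∈ evenPairs ℓ, A ⊆ range ℓ := by
  intro q hq
  obtain ⟨a, u, h1, h2, rfl⟩ := mem_evenPairs.1 hq
  intro x hx
  simp only [mem_insert, mem_singleton] at hx
  rw [mem_range]
  omega

theorem card_of_mem_quads {ℓ : ℕ} {q : Finset ℕ} (hq : q ∈ quads ℓ) : q.card = 4 := by
  obtain ⟨a, u, v, h1, h2, h3, rfl⟩ := mem_quads.1 hq
  rw [card_insert_of_notMem, card_insert_of_notMem, card_pair]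
  · omega
  all_goals simp only [mem_insert, mem_singleton]; omega

theorem card_of_mem_evenPairs {ℓ : ℕ} {q : Finset ℕ} (hq : q ∈ evenPairs ℓ) : q.card = 2 := by
  obtain ⟨a, u, h1, h2, rfl⟩ := mem_evenPairs.1 hq
  rw [card_pair]
  omega

theorem parallelogram_injOn (ℓ : ℕ) :
    Set.InjOn parallelogram ((triples ℓ).filter fun t => t.2.1 < t.2.2 : Finset _) := by
  rintro ⟨a, u, v⟩ h ⟨b, w, z⟩ h' heq
  simp only [coe_filter, Set.mem_ofPred_eq, mem_triples] at h h'
  have key : ∀ x, x ∈ parallelogram (a, u, v) ↔ x ∈ parallelogram (b, w, z) := by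
    intro x; rw [heq]
  simp only [parallelogram, mem_insert, mem_singleton] at key
  -- Equal sets have equal minima, then equal maxima; since `u < v`, the second smallest element
  -- then determines `u`.
  have h1 := (key a).1 (by simp)
  have h2 := (key b).2 (by simp)
  have hab : a = b := by omega
  have h3 := (key (a + u + v)).1 (by simp)
  have h4 := (key (b + w + z)).2 (by simp)
  have hs : u + v = w + z := by omega
  have h5 := (key (a + u)).1 (by simp)
  have : u = w := by omega
  ext <;> simp <;> omega

theorem evenPair_injOn (ℓ : ℕ) :
    Set.InjOn (fun t : ℕ × ℕ × ℕ => ({t.1, t.1 + t.2.1 + t.2.2} : Finset ℕ))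
      ((triples ℓ).filter fun t => t.2.1 = t.2.2 : Finset _) := by
  rintro ⟨a, u, v⟩ h ⟨b, w, z⟩ h' heq
  simp only [coe_filter, Set.mem_ofPred_eq, mem_triples] at h h'
  have key : ∀ x, x ∈ ({a, a + u + v} : Finset ℕ) ↔ x ∈ ({b, b + w + z} : Finset ℕ) :=
    Finset.ext_iff.1 heq
  simp only [mem_insert, mem_singleton] at key
  have h1 := (key a).1 (by simp)
  have h2 := (key b).2 (by simp)
  have hab : a = b := by omega
  have h3 := (key (a + u + v)).1 (by simp)
  have h4 := (key (b + w + z)).2 (by simp)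
  ext <;> simp <;> omega

/-- Turns the cross terms of the squared autocorrelations into parallelograms: one side is the
shift, `u = s + 1`, the other is the distance `v = b - a` of the two summands. -/
theorem sum_range_eq_sum_triples (ℓ : ℕ) (g : ℕ → ℕ → ℕ → ℝ) :
    ∑ s ∈ range ℓ, ∑ b ∈ range (ℓ - (s + 1)), ∑ a ∈ range b, g a (s + 1) (b - a)
      = ∑ t ∈ triples ℓ, g t.1 t.2.1 t.2.2 := by
  simp_rw [sum_sigma']
  refine sum_bij' (fun x _ => (x.2.2, x.1 + 1, x.2.1 - x.2.2))
    (fun t _ => ⟨t.2.1 - 1, t.1 + t.2.2, t.1⟩) ?_ ?_ ?_ ?_ ?_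
  · rintro ⟨s, b, a⟩ h
    simp only [mem_sigma, mem_range] at h
    rw [mem_triples]
    dsimp only
    omega
  · rintro ⟨a, u, v⟩ h
    rw [mem_triples] at h
    simp only [mem_sigma, mem_range]
    omega
  · rintro ⟨s, b, a⟩ h
    simp only [mem_sigma, mem_range] at h
    have h1 : a + (b - a) = b := by omega
    simp [h1]
  · rintro ⟨a, u, v⟩ h
    rw [mem_triples] at h
    ext <;> simp
    omega
  · intro x _
    rfl

theorem sum_triples_eq {ℓ : ℕ} {f : ℤ → ℂ} (hf : f ∈ binarySeqs ℓ) :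
    ∑ t ∈ triples ℓ, (f t.1).re * (f (t.1 + t.2.1 : ℕ)).re
        * ((f (t.1 + t.2.2 : ℕ)).re * (f (t.1 + t.2.1 + t.2.2 : ℕ)).re)
      = ∑ A ∈ evenPairs ℓ, chi A f + 2 * ∑ q ∈ quads ℓ, chi q f := by
  set g : ℕ × ℕ × ℕ → ℝ := fun t => (f t.1).re * (f (t.1 + t.2.1 : ℕ)).re
        * ((f (t.1 + t.2.2 : ℕ)).re * (f (t.1 + t.2.1 + t.2.2 : ℕ)).re) with hg
  have h1 : ∑ q ∈ quads ℓ, chi q f = ∑ t ∈ (triples ℓ).filter (fun t => t.2.1 < t.2.2), g t := by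
    rw [quads, sum_image (parallelogram_injOn ℓ)]
    refine sum_congr rfl ?_
    rintro ⟨a, u, v⟩ ht
    simp only [mem_filter, mem_triples] at ht
    simp only [chi, parallelogram, hg]
    rw [prod_insert, prod_insert, prod_pair]
    · ring
    · omega
    all_goals simp only [mem_insert, mem_singleton]; omega
  have h2 : ∑ t ∈ (triples ℓ).filter (fun t => t.2.1 < t.2.2), g t
      = ∑ t ∈ (triples ℓ).filter (fun t => t.2.2 < t.2.1), g t := by
    refine sum_bij' (fun t _ => (t.1, t.2.2, t.2.1)) (fun t _ => (t.1, t.2.2, t.2.1))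
      ?_ ?_ ?_ ?_ ?_
    · rintro ⟨a, u, v⟩ h
      simp only [mem_filter, mem_triples] at h ⊢
      omega
    · rintro ⟨a, u, v⟩ h
      simp only [mem_filter, mem_triples] at h ⊢
      omega
    · intro t _
      rfl
    · intro t _
      rfl
    · rintro ⟨a, u, v⟩ _
      simp only [hg, add_right_comm a v u]
      ring
  have h3 : ∑ A ∈ evenPairs ℓ, chi A f
      = ∑ t ∈ (triples ℓ).filter (fun t => t.2.1 = t.2.2), g t := by
    rw [evenPairs, sum_image (evenPair_injOn ℓ)]
    refine sum_congr rfl ?_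
    rintro ⟨a, u, v⟩ ht
    simp only [mem_filter, mem_triples] at ht
    obtain ⟨h, rfl⟩ := ht
    simp only [chi, hg]
    rw [prod_pair (by omega)]
    have := binarySeqs_re_mul_self hf (j := a + u) (by omega)
    linear_combination (-(f a).re * (f (a + u + u : ℕ)).re) * this
  have h4 : ∑ t ∈ triples ℓ, g t = ∑ t ∈ (triples ℓ).filter (fun t => t.2.1 = t.2.2), g t
      + (∑ t ∈ (triples ℓ).filter (fun t => t.2.1 < t.2.2), g t
      + ∑ t ∈ (triples ℓ).filter (fun t => t.2.2 < t.2.1), g t) := by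
    simp_rw [sum_filter]
    rw [← sum_add_distrib, ← sum_add_distrib]
    refine sum_congr rfl fun t _ => ?_
    rcases lt_trichotomy t.2.1 t.2.2 with h | h | h
    · simp [h, h.ne, h.not_gt]
    · simp [h]
    · simp [h, h.ne', h.not_gt]
  rw [h4, ← h2, ← h1, ← h3]
  ring

theorem ssac_eq {ℓ : ℕ} {f : ℤ → ℂ} (hf : f ∈ binarySeqs ℓ) :
    ssac f = ((ℓ : ℝ) ^ 2 + 2 * ∑ s ∈ range ℓ, ((ℓ - (s + 1) : ℕ) : ℝ))
      + 4 * (∑ A ∈ evenPairs ℓ, chi A f + 2 * ∑ q ∈ quads ℓ, chi q f) := by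
  rw [ssac_eq_sum_range hf, ← sum_triples_eq hf, ← sum_range_eq_sum_triples ℓ fun a u v =>
    (f a).re * (f (a + u : ℕ)).re * ((f (a + v : ℕ)).re * (f (a + u + v : ℕ)).re)]
  have h : ∀ s ∈ range ℓ,
      (∑ a ∈ range (ℓ - (s + 1)), (f a).re * (f (a + (s + 1) : ℕ)).re) ^ 2
      = ((ℓ - (s + 1) : ℕ) : ℝ) + 2 * ∑ b ∈ range (ℓ - (s + 1)), ∑ a ∈ range b,
        (f a).re * (f (a + (s + 1) : ℕ)).re
          * ((f (a + (b - a) : ℕ)).re * (f (a + (s + 1) + (b - a) : ℕ)).re) := by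
    intro s _
    rw [sum_range_sq]
    congr 1
    · rw [sum_congr rfl (g := fun _ => (1 : ℝ))]
      · simp
      · intro a ha
        rw [mem_range] at ha
        have h1 := binarySeqs_re_mul_self hf (j := a) (by omega)
        have h2 := binarySeqs_re_mul_self hf (j := a + (s + 1)) (by omega)
        rw [sq, mul_mul_mul_comm, h1, h2, one_mul]
    · congr 1
      refine sum_congr rfl fun b _ => sum_congr rfl fun a ha => ?_
      rw [mem_range] at ha
      rw [show a + (b - a) = b by omega, show a + (s + 1) + (b - a) = b + (s + 1) by omega]
  rw [sum_congr rfl h, sum_add_distrib, ← mul_sum]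
  ring

/-! ### Membership criteria for pairs and quads -/

theorem pair_mem_evenPairs {ℓ v w : ℕ} :
    {v, w} ∈ evenPairs ℓ ↔ v < ℓ ∧ w < ℓ ∧ v ≠ w ∧ v % 2 = w % 2 := by
  rw [mem_evenPairs]
  constructor
  · rintro ⟨a, d, h1, h2, h3⟩
    have key := Finset.ext_iff.1 h3
    simp only [mem_insert, mem_singleton] at key
    have h4 := (key v).1 (by simp)
    have h5 := (key w).1 (by simp)
    have h6 := (key a).2 (by simp)
    have h7 := (key (a + 2 * d)).2 (by simp)
    omega
  · rintro ⟨h1, h2, h3, h4⟩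
    rcases lt_or_gt_of_ne h3 with h | h
    · refine ⟨v, (w - v) / 2, by omega, by omega, ?_⟩
      rw [show v + 2 * ((w - v) / 2) = w by omega]
    · refine ⟨w, (v - w) / 2, by omega, by omega, ?_⟩
      rw [show w + 2 * ((v - w) / 2) = v by omega, pair_comm]

theorem quad_mem_quads_of_add_eq {ℓ p q r s : ℕ} (hp : p < ℓ) (hq : q < ℓ) (hr : r < ℓ)
    (hs : s < ℓ) (hpq : p ≠ q) (hrs : r ≠ s) (hpr : p ≠ r) (hps : p ≠ s)
    (h : p + q = r + s) : {p, q, r, s} ∈ quads ℓ := by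
  wlog h1 : p < q generalizing p q
  · rw [insert_comm]
    exact this hq hp hpq.symm (by omega) (by omega) (by omega) (by omega)
  wlog h2 : r < s generalizing r s
  · rw [pair_comm]
    exact this hs hr hrs.symm hps hpr (by omega) (by omega)
  wlog h3 : p < r generalizing p q r s
  · have : ({p, q, r, s} : Finset ℕ) = {r, s, p, q} := by
      ext x
      simp only [mem_insert, mem_singleton]
      tauto
    rw [this]
    apply_assumption <;> omega
  rw [mem_quads]
  -- With `p` least, the equal sums make `q` the largest, so `r < s` are the middle elements `a + u`
  -- and `a + v`.
  refine ⟨p, r - p, s - p, by omega, by omega, by omega, ?_⟩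
  rw [show p + (r - p) = r by omega, show p + (s - p) = s by omega,
    show r + (s - p) = q by omega]
  ext x
  simp only [mem_insert, mem_singleton]
  tauto

theorem quad_mem_quads {ℓ p q r s : ℕ} (hp : p < ℓ) (hq : q < ℓ) (hr : r < ℓ)
    (hs : s < ℓ) (hpq : p ≠ q) (hpr : p ≠ r) (hps : p ≠ s) (hqr : q ≠ r) (hqs : q ≠ s)
    (hrs : r ≠ s) :
    {p, q, r, s} ∈ quads ℓ ↔ p + q = r + s ∨ p + r = q + s ∨ p + s = q + r := by
  constructor
  · rw [mem_quads]
    rintro ⟨a, u, v, h1, h2, h3, h4⟩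
    have key := Finset.ext_iff.1 h4
    simp only [mem_insert, mem_singleton] at key
    have hp' := (key p).1 (by simp)
    have hq' := (key q).1 (by simp)
    have hr' := (key r).1 (by simp)
    have hs' := (key s).1 (by simp)
    clear key h4
    -- Once `p` and `q` are placed among the four points, distinctness leaves `r` and `s` the other
    -- two, and the least and greatest points always balance the middle ones.
    rcases hp' with rfl | rfl | rfl | rfl <;> rcases hq' with rfl | rfl | rfl | rfl <;> omega
  · rintro (h | h | h)
    · exact quad_mem_quads_of_add_eq hp hq hr hs hpq hrs hpr hps h
    · rw [show ({p, q, r, s} : Finset ℕ) = {p, r, q, s} by rw [insert_comm q r]]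
      exact quad_mem_quads_of_add_eq hp hr hq hs hpr hqs hpq hps h
    · rw [show ({p, q, r, s} : Finset ℕ) = {p, s, q, r} by
        rw [pair_comm r s, insert_comm q s]]
      exact quad_mem_quads_of_add_eq hp hs hq hr hps hqr hpq hpr h

/-! ### Reducing symmetric-difference counts to local data -/

/-- The elements that extend `T` to a member of `F`. -/
def extensions (ℓ : ℕ) (F : Finset (Finset ℕ)) (T : Finset ℕ) : Finset ℕ :=
  (range ℓ).filter fun w => w ∉ T ∧ insert w T ∈ F

theorem insert_inter_insert {T : Finset ℕ} {w z : ℕ} (hw : w ∉ T) (hwz : w ≠ z) :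
    insert w T ∩ insert z T = T := by
  rw [insert_inter_of_notMem (by simp [hw, hwz]), inter_eq_left]
  exact subset_insert z T

theorem insert_symmDiff_insert {T : Finset ℕ} {w z : ℕ} (hw : w ∉ T) (hz : z ∉ T) (hwz : w ≠ z) :
    symmDiff (insert w T) (insert z T) = {w, z} := by
  ext x
  simp only [mem_symmDiff, mem_insert, mem_singleton]
  by_cases hx : x ∈ T
  · have h1 : x ≠ w := fun h => hw (h ▸ hx)
    have h2 : x ≠ z := fun h => hz (h ▸ hx)
    simp [hx, h1, h2]
  · simp only [hx, or_false]
    constructor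
    · tauto
    · rintro (h | h)
      · exact Or.inl ⟨h, fun h' => hwz (h ▸ h')⟩
      · exact Or.inr ⟨h, fun h' => hwz (h' ▸ h)⟩

/-- Pairs of members of a uniform family that differ by a two-element exchange, counted
through their common part. -/
theorem card_symmDiffPairs_eq_sum_offDiag {ℓ k : ℕ} {F H : Finset (Finset ℕ)}
    (hF : ∀ A ∈ F, A ⊆ range ℓ) (hFk : ∀ A ∈ F, A.card = k + 1) (hH : ∀ A ∈ H, A.card = 2)
    (hFH : ∀ T : Finset ℕ, ∀ w z, T.card = k → w ∉ T → z ∉ T → w ≠ z → insert w T ∈ F →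
      insert z T ∈ F → {w, z} ∈ H) :
    (symmDiffPairs F F H).card
      = ∑ T ∈ powersetCard k (range ℓ), (extensions ℓ F T).offDiag.card := by
  rw [← card_sigma]
  symm
  refine card_bij (fun x _ => (insert x.2.1 x.1, insert x.2.2 x.1)) ?_ ?_ ?_
  · rintro ⟨T, w, z⟩ h
    simp only [mem_sigma, mem_powersetCard, mem_offDiag, extensions, mem_filter] at h
    obtain ⟨⟨-, hT⟩, ⟨-, hw, hwF⟩, ⟨-, hz, hzF⟩, hwz⟩ := h
    simp only [symmDiffPairs, mem_filter, mem_product, insert_symmDiff_insert hw hz hwz]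
    exact ⟨⟨hwF, hzF⟩, hFH T w z hT hw hz hwz hwF hzF⟩
  · rintro ⟨T, w, z⟩ h ⟨T', w', z'⟩ h' heq
    simp only [mem_sigma, mem_powersetCard, mem_offDiag, extensions, mem_filter] at h h'
    obtain ⟨-, ⟨-, hw, -⟩, ⟨-, hz, -⟩, hwz⟩ := h
    obtain ⟨-, ⟨-, hw', -⟩, ⟨-, hz', -⟩, hwz'⟩ := h'
    simp only [Prod.mk.injEq] at heq
    have hT : T = T' := by
      rw [← insert_inter_insert hw hwz, heq.1, heq.2, insert_inter_insert hw' hwz']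
    subst hT
    rw [(insert_inj hw).1 heq.1, (insert_inj hz).1 heq.2]
  · rintro ⟨A, B⟩ h
    simp only [symmDiffPairs, mem_filter, mem_product] at h
    obtain ⟨⟨hA, hB⟩, hAB⟩ := h
    have h1 := hH _ hAB
    rw [symmDiff_def, sup_eq_union, card_union_of_disjoint disjoint_sdiff_sdiff] at h1
    have h2 := card_sdiff_add_card_inter A B
    have h3 := card_sdiff_add_card_inter B A
    rw [inter_comm B A] at h3
    rw [hFk A hA] at h2
    rw [hFk B hB] at h3
    -- `A` and `B` have equal size, so the two elements of the symmetric difference lie one on each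
    -- side.
    obtain ⟨w, hw⟩ := card_eq_one.1 (show (A \ B).card = 1 by omega)
    obtain ⟨z, hz⟩ := card_eq_one.1 (show (B \ A).card = 1 by omega)
    have hwA : insert w (A ∩ B) = A := by
      rw [insert_eq, ← hw, sdiff_union_inter]
    have hzB : insert z (A ∩ B) = B := by
      rw [insert_eq, ← hz, inter_comm, sdiff_union_inter]
    have hw' : w ∈ A \ B := by simp [hw]
    have hz' : z ∈ B \ A := by simp [hz]
    rw [mem_sdiff] at hw' hz'
    refine ⟨⟨A ∩ B, w, z⟩, ?_, by simp only [hwA, hzB]⟩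
    simp only [mem_sigma, mem_powersetCard, mem_offDiag, extensions, mem_filter, hwA, hzB,
      mem_inter]
    refine ⟨⟨inter_subset_left.trans (hF A hA), by omega⟩, ⟨hF A hA hw'.1, by tauto, hA⟩,
      ⟨hF B hB hz'.1, by tauto, hB⟩, ?_⟩
    rintro rfl
    tauto

/-- Two disjoint sets whose union belongs to the family `Q`. -/
def Matched (Q : Finset (Finset ℕ)) (A B : Finset ℕ) : Prop := Disjoint A B ∧ A ∪ B ∈ Q

instance (Q : Finset (Finset ℕ)) (A B : Finset ℕ) : Decidable (Matched Q A B) :=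
  inferInstanceAs (Decidable (_ ∧ _))

/-- A triangle of four-element sets under symmetric difference is determined by three
pairwise disjoint two-element sets. -/
theorem card_symmDiffPairs_self {ℓ : ℕ} {Q : Finset (Finset ℕ)}
    (hQ : ∀ A ∈ Q, A ⊆ range ℓ) (hQ4 : ∀ A ∈ Q, A.card = 4) :
    (symmDiffPairs Q Q Q).card
      = ((powersetCard 2 (range ℓ) ×ˢ powersetCard 2 (range ℓ) ×ˢ
        powersetCard 2 (range ℓ)).filter fun t =>
          Matched Q t.1 t.2.1 ∧ Matched Q t.1 t.2.2 ∧ Matched Q t.2.1 t.2.2).card := by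
  symm
  -- In the inverse map all three blocks have two elements: `A`, `B` and their symmetric difference
  -- all have size 4.
  refine card_bij' (fun t _ => (t.1 ∪ t.2.1, t.1 ∪ t.2.2))
    (fun p _ => (p.1 ∩ p.2, p.1 \ p.2, p.2 \ p.1)) ?_ ?_ ?_ ?_
  · rintro ⟨A, B, C⟩ h
    simp only [mem_filter, mem_product] at h
    obtain ⟨-, ⟨h1, h2⟩, ⟨h3, h4⟩, h5, h6⟩ := h
    simp only [symmDiffPairs, mem_filter, mem_product]
    refine ⟨⟨h2, h4⟩, ?_⟩
    convert h6 using 1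
    rw [disjoint_left] at h1 h3 h5
    ext x
    have := @h1 x
    have := @h3 x
    have := @h5 x
    simp only [mem_symmDiff, mem_union]
    tauto
  · rintro ⟨A, B⟩ h
    simp only [symmDiffPairs, mem_filter, mem_product] at h
    obtain ⟨⟨hA, hB⟩, hAB⟩ := h
    have h1 := hQ4 _ hAB
    have hAB' := hAB
    rw [symmDiff_def, sup_eq_union, card_union_of_disjoint disjoint_sdiff_sdiff] at h1
    rw [symmDiff_def, sup_eq_union] at hAB'
    have h2 := card_sdiff_add_card_inter A B
    have h3 := card_sdiff_add_card_inter B A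
    rw [inter_comm B A] at h3
    rw [hQ4 A hA] at h2
    rw [hQ4 B hB] at h3
    simp only [mem_filter, mem_product, mem_powersetCard]
    refine ⟨⟨⟨inter_subset_left.trans (hQ A hA), by omega⟩,
      ⟨sdiff_subset.trans (hQ A hA), by omega⟩, ⟨sdiff_subset.trans (hQ B hB), by omega⟩⟩,
      ⟨(disjoint_sdiff_inter A B).symm, ?_⟩, ⟨?_, ?_⟩, disjoint_sdiff_sdiff, hAB'⟩
    · rwa [union_comm, sdiff_union_inter]
    · rw [inter_comm]
      exact (disjoint_sdiff_inter B A).symm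
    · rwa [inter_comm, union_comm, sdiff_union_inter]
  · rintro ⟨A, B, C⟩ h
    simp only [mem_filter, mem_product] at h
    obtain ⟨-, ⟨h1, -⟩, ⟨h3, -⟩, h5, -⟩ := h
    rw [disjoint_left] at h1 h3 h5
    simp only [Prod.mk.injEq]
    refine ⟨?_, ?_, ?_⟩ <;>
    · ext x
      have := @h1 x
      have := @h3 x
      have := @h5 x
      simp only [mem_inter, mem_sdiff, mem_union]
      tauto
  · rintro ⟨A, B⟩ h
    simp only [Prod.mk.injEq]
    refine ⟨?_, ?_⟩ <;>
    · ext x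
      simp only [mem_inter, mem_sdiff, mem_union]
      tauto

/-- Two-element sets have a symmetric difference of size 4 only when they are disjoint, and then it
is their union. -/
theorem symmDiffPairs_eq_filter_matched {F Q : Finset (Finset ℕ)} (hF : ∀ A ∈ F, A.card = 2)
    (hQ4 : ∀ A ∈ Q, A.card = 4) :
    symmDiffPairs F F Q = (F ×ˢ F).filter fun p => Matched Q p.1 p.2 := by
  refine filter_congr ?_
  rintro ⟨A, B⟩ h
  rw [mem_product] at h
  constructor
  · intro h'
    have h1 : (symmDiff A B).card = 4 := hQ4 _ h'
    rw [symmDiff_def, sup_eq_union, card_union_of_disjoint disjoint_sdiff_sdiff] at h1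
    have h2 := card_sdiff_add_card_inter A B
    rw [hF A h.1] at h2
    have h3 : (B \ A).card ≤ B.card := card_le_card sdiff_subset
    rw [hF B h.2] at h3
    have hd : Disjoint A B := by
      rw [disjoint_iff_inter_eq_empty, ← card_eq_zero]
      omega
    refine ⟨hd, ?_⟩
    rwa [← sup_eq_union, ← hd.symmDiff_eq_sup]
  · rintro ⟨h1, h2⟩
    rwa [h1.symmDiff_eq_sup, sup_eq_union]

/-! ### Coordinates for two- and three-element subsets -/

/-- Pairs `(a, d)` with positive `d` and `a + d < ℓ`. -/
def pairs (ℓ : ℕ) : Finset (ℕ × ℕ) :=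
  (range ℓ ×ˢ range ℓ).filter fun p => 0 < p.2 ∧ p.1 + p.2 < ℓ

theorem mem_pairs {ℓ a d : ℕ} : (a, d) ∈ pairs ℓ ↔ 0 < d ∧ a + d < ℓ := by
  simp only [pairs, mem_filter, mem_product, mem_range]
  omega

theorem sum_powersetCard_two {M : Type*} [AddCommMonoid M] (ℓ : ℕ) (g : Finset ℕ → M) :
    ∑ A ∈ powersetCard 2 (range ℓ), g A = ∑ p ∈ pairs ℓ, g {p.1, p.1 + p.2} := by
  symm
  refine sum_bij (fun p _ => {p.1, p.1 + p.2}) ?_ ?_ ?_ fun _ _ => rfl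
  · rintro ⟨a, d⟩ h
    rw [mem_pairs] at h
    rw [mem_powersetCard, card_pair (by dsimp only; omega)]
    refine ⟨?_, rfl⟩
    intro x
    simp only [mem_insert, mem_singleton, mem_range]
    omega
  · rintro ⟨a, d⟩ h ⟨b, e⟩ h' heq
    rw [mem_pairs] at h h'
    have key := Finset.ext_iff.1 heq
    simp only [mem_insert, mem_singleton] at key
    have h1 := (key a).1 (by simp)
    have h2 := (key b).2 (by simp)
    have h3 := (key (a + d)).1 (by simp)
    have h4 := (key (b + e)).2 (by simp)
    ext <;> simp <;> omega
  · intro A hA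
    rw [mem_powersetCard] at hA
    obtain ⟨x, y, hxy, rfl⟩ := card_eq_two.1 hA.2
    have hx := mem_range.1 (hA.1 (mem_insert_self x _))
    have hy := mem_range.1 (hA.1 (mem_insert_of_mem (mem_singleton_self y)))
    rcases lt_or_gt_of_ne hxy with h | h
    · refine ⟨(x, y - x), mem_pairs.2 (by omega), ?_⟩
      simp only [show x + (y - x) = y by omega]
    · refine ⟨(y, x - y), mem_pairs.2 (by omega), ?_⟩
      simp only [show y + (x - y) = x by omega, pair_comm x y]

theorem exists_triple_of_mem_powersetCard_three {ℓ : ℕ} {A : Finset ℕ}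
    (hA : A ∈ powersetCard 3 (range ℓ)) :
    ∃ x u v, (x, u, v) ∈ triples ℓ ∧ A = {x, x + u, x + u + v} := by
  have main : ∀ x y z : ℕ, x < y → y < z → z < ℓ → ∃ a u v, (a, u, v) ∈ triples ℓ ∧
      ({x, y, z} : Finset ℕ) = {a, a + u, a + u + v} := by
    intro x y z hxy hyz hz
    refine ⟨x, y - x, z - y, mem_triples.2 (by omega), ?_⟩
    simp only [show x + (y - x) = y by omega, show y + (z - y) = z by omega]
  rw [mem_powersetCard] at hA
  obtain ⟨x, y, z, hxy, hxz, hyz, rfl⟩ := card_eq_three.1 hA.2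
  have hx := mem_range.1 (hA.1 (by simp : x ∈ _))
  have hy := mem_range.1 (hA.1 (by simp : y ∈ _))
  have hz := mem_range.1 (hA.1 (by simp : z ∈ _))
  rcases lt_or_gt_of_ne hxy with h1 | h1 <;> rcases lt_or_gt_of_ne hxz with h2 | h2 <;>
    rcases lt_or_gt_of_ne hyz with h3 | h3
  · exact main x y z h1 h3 hz
  · rw [pair_comm]
    exact main x z y h2 h3 hy
  · omega
  · rw [pair_comm, insert_comm]
    exact main z x y h2 h1 hy
  · rw [insert_comm]
    exact main y x z h1 h2 hz
  · omega
  · rw [insert_comm, pair_comm]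
    exact main y z x h3 h2 hx
  · rw [pair_comm, insert_comm, pair_comm]
    exact main z y x h3 h1 hx

theorem sum_powersetCard_three {M : Type*} [AddCommMonoid M] (ℓ : ℕ) (g : Finset ℕ → M) :
    ∑ A ∈ powersetCard 3 (range ℓ), g A
      = ∑ t ∈ triples ℓ, g {t.1, t.1 + t.2.1, t.1 + t.2.1 + t.2.2} := by
  symm
  refine sum_bij (fun t _ => {t.1, t.1 + t.2.1, t.1 + t.2.1 + t.2.2}) ?_ ?_ ?_ fun _ _ => rfl
  · rintro ⟨a, u, v⟩ h
    rw [mem_triples] at h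
    rw [mem_powersetCard, card_eq_three]
    refine ⟨?_, a, a + u, a + u + v, by omega, by omega, by omega, rfl⟩
    intro x
    simp only [mem_insert, mem_singleton, mem_range]
    omega
  · rintro ⟨a, u, v⟩ h ⟨b, w, z⟩ h' heq
    rw [mem_triples] at h h'
    have key := Finset.ext_iff.1 heq
    simp only [mem_insert, mem_singleton] at key
    have h1 := (key a).1 (by simp)
    have h2 := (key b).2 (by simp)
    have h3 := (key (a + u + v)).1 (by simp)
    have h4 := (key (b + w + z)).2 (by simp)
    have h5 := (key (a + u)).1 (by simp)
    ext <;> simp <;> omega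
  · intro A hA
    obtain ⟨x, u, v, ht, h⟩ := exists_triple_of_mem_powersetCard_three hA
    exact ⟨(x, u, v), ht, h.symm⟩

/-! ### Triangles of three quads -/

/-- Of the three ways to balance the four points, pairing the two given sets against each other
means equal sums, and pairing each lower end with the other's upper end means equal differences. The
two lower ends against the two upper ends can never balance. The inequalities express disjointness.
-/
theorem matched_quads_iff {ℓ a d b e : ℕ} (h1 : (a, d) ∈ pairs ℓ) (h2 : (b, e) ∈ pairs ℓ) :
    Matched (quads ℓ) {a, a + d} {b, b + e} ↔
      (2 * a + d = 2 * b + e ∧ a ≠ b) ∨ (d = e ∧ a ≠ b ∧ a ≠ b + d ∧ b ≠ a + d) := by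
  rw [mem_pairs] at h1 h2
  have hdisj : Disjoint ({a, a + d} : Finset ℕ) {b, b + e} ↔
      a ≠ b ∧ a ≠ b + e ∧ a + d ≠ b ∧ a + d ≠ b + e := by
    simp only [disjoint_insert_left, disjoint_singleton_left, mem_insert, mem_singleton]
    tauto
  unfold Matched
  rw [hdisj, insert_union, singleton_union]
  constructor
  · rintro ⟨h3, h4⟩
    rw [quad_mem_quads] at h4 <;> omega
  · intro h
    have h3 : a ≠ b ∧ a ≠ b + e ∧ a + d ≠ b ∧ a + d ≠ b + e := by omega
    refine ⟨h3, ?_⟩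
    rw [quad_mem_quads] <;> omega

/-- Triangles of quads under symmetric difference correspond to triples of pairs that share
either their sum or their difference. -/
theorem card_symmDiffPairs_quads (ℓ : ℕ) :
    (symmDiffPairs (quads ℓ) (quads ℓ) (quads ℓ)).card
      = ((pairs ℓ ×ˢ pairs ℓ ×ˢ pairs ℓ).filter fun t =>
          (2 * t.1.1 + t.1.2 = 2 * t.2.1.1 + t.2.1.2 ∧ 2 * t.1.1 + t.1.2 = 2 * t.2.2.1 + t.2.2.2) ∧
            t.1.1 ≠ t.2.1.1 ∧ t.1.1 ≠ t.2.2.1 ∧ t.2.1.1 ≠ t.2.2.1).card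
      + ((pairs ℓ ×ˢ pairs ℓ ×ˢ pairs ℓ).filter fun t =>
          (t.1.2 = t.2.1.2 ∧ t.1.2 = t.2.2.2) ∧
            (t.1.1 ≠ t.2.1.1 ∧ t.1.1 ≠ t.2.1.1 + t.1.2 ∧ t.2.1.1 ≠ t.1.1 + t.1.2) ∧
            (t.1.1 ≠ t.2.2.1 ∧ t.1.1 ≠ t.2.2.1 + t.1.2 ∧ t.2.2.1 ≠ t.1.1 + t.1.2) ∧
            (t.2.1.1 ≠ t.2.2.1 ∧ t.2.1.1 ≠ t.2.2.1 + t.1.2 ∧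
              t.2.2.1 ≠ t.2.1.1 + t.1.2)).card := by
  rw [card_symmDiffPairs_self quads_subset_range fun _ => card_of_mem_quads, card_filter,
    sum_product, sum_powersetCard_two]
  simp_rw [sum_product, sum_powersetCard_two]
  rw [card_filter, card_filter, ← sum_add_distrib, sum_product]
  simp_rw [sum_product]
  refine sum_congr rfl ?_
  rintro ⟨a, d⟩ h1
  refine sum_congr rfl ?_
  rintro ⟨b, e⟩ h2
  refine sum_congr rfl ?_
  rintro ⟨c, g⟩ h3
  simp only [matched_quads_iff h1 h2, matched_quads_iff h1 h3, matched_quads_iff h2 h3]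
  rw [mem_pairs] at h1 h2 h3
  split_ifs with h4 h5 h6 h6 h5 h6 h6
  · omega
  · rfl
  · rfl
  · exfalso
    -- Mixed kinds are impossible: two relations of one kind imply the third of that kind, and if it
    -- were also of the other kind, two of the pairs would have equal sum and equal difference and
    -- so coincide.
    obtain ⟨h4 | h4, h7 | h7, h8 | h8⟩ := h4 <;> omega
  · omega
  · exact absurd ⟨Or.inl ⟨h5.1.1, h5.2.1⟩, Or.inl ⟨h5.1.2, h5.2.2.1⟩,
      Or.inl ⟨by omega, h5.2.2.2⟩⟩ h4
  · refine absurd ⟨Or.inr ⟨h6.1.1, h6.2.1⟩, Or.inr ⟨h6.1.2, h6.2.2.1⟩,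
      Or.inr ⟨by omega, ?_⟩⟩ h4
    have := h6.2.2.2
    rwa [h6.1.1] at this
  · rfl

theorem card_distinct_triples (s : Finset ℕ) :
    (((s ×ˢ s ×ˢ s).filter fun t => t.1 ≠ t.2.1 ∧ t.1 ≠ t.2.2 ∧ t.2.1 ≠ t.2.2).card : ℝ)
      = s.card * (s.card - 1) * (s.card - 2) := by
  have h : ((s ×ˢ s ×ˢ s).filter fun t => t.1 ≠ t.2.1 ∧ t.1 ≠ t.2.2 ∧ t.2.1 ≠ t.2.2).card
      = (s.sigma fun a => (s.erase a).offDiag).card := by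
    refine card_bij' (fun t _ => ⟨t.1, t.2⟩) (fun x _ => (x.1, x.2)) ?_ ?_ (fun _ _ => rfl)
      fun _ _ => rfl
    · rintro ⟨a, b, c⟩ h
      simp only [mem_filter, mem_product] at h
      simp only [mem_sigma, mem_offDiag, mem_erase]
      tauto
    · rintro ⟨a, b, c⟩ h
      simp only [mem_sigma, mem_offDiag, mem_erase] at h
      simp only [mem_filter, mem_product]
      tauto
  rw [h, card_sigma, sum_congr rfl fun a ha => by rw [offDiag_card, card_erase_of_mem ha],
    sum_const, smul_eq_mul]
  rcases Nat.eq_zero_or_pos s.card with h0 | h0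
  · simp [h0]
  · obtain ⟨k, hk⟩ := Nat.exists_eq_add_of_lt h0
    rw [hk, show 0 + k + 1 - 1 = k by omega, Nat.cast_mul, Nat.cast_sub (Nat.le_mul_self k)]
    push_cast
    ring

/-- For a fixed sum `σ` a pair is determined by its lower end `a`. The conditions `a < σ - a` and `σ
- a < ℓ` cut out the interval `Ico (σ + 1 - ℓ) ((σ + 1) / 2)`. -/
theorem card_same_sum_triples (ℓ : ℕ) :
    ((pairs ℓ ×ˢ pairs ℓ ×ˢ pairs ℓ).filter fun t =>
      (2 * t.1.1 + t.1.2 = 2 * t.2.1.1 + t.2.1.2 ∧ 2 * t.1.1 + t.1.2 = 2 * t.2.2.1 + t.2.2.2) ∧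
        t.1.1 ≠ t.2.1.1 ∧ t.1.1 ≠ t.2.2.1 ∧ t.2.1.1 ≠ t.2.2.1).card
    = ∑ σ ∈ range (2 * ℓ), ((Ico (σ + 1 - ℓ) ((σ + 1) / 2) ×ˢ Ico (σ + 1 - ℓ) ((σ + 1) / 2) ×ˢ
        Ico (σ + 1 - ℓ) ((σ + 1) / 2)).filter fun t =>
          t.1 ≠ t.2.1 ∧ t.1 ≠ t.2.2 ∧ t.2.1 ≠ t.2.2).card := by
  rw [← card_sigma]
  refine card_bij' (fun t _ => ⟨2 * t.1.1 + t.1.2, t.1.1, t.2.1.1, t.2.2.1⟩)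
    (fun x _ => ((x.2.1, x.1 - 2 * x.2.1), (x.2.2.1, x.1 - 2 * x.2.2.1),
      (x.2.2.2, x.1 - 2 * x.2.2.2))) ?_ ?_ ?_ ?_
  · rintro ⟨⟨a, d⟩, ⟨b, e⟩, ⟨c, g⟩⟩ h
    simp only [mem_filter, mem_product, mem_pairs] at h
    simp only [mem_sigma, mem_filter, mem_product, mem_range, mem_Ico]
    omega
  · rintro ⟨σ, a, b, c⟩ h
    simp only [mem_sigma, mem_filter, mem_product, mem_range, mem_Ico] at h
    simp only [mem_filter, mem_product, mem_pairs]
    omega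
  · rintro ⟨⟨a, d⟩, ⟨b, e⟩, ⟨c, g⟩⟩ h
    simp only [mem_filter, mem_product, mem_pairs] at h
    simp only [Prod.mk.injEq, true_and]
    omega
  · rintro ⟨σ, a, b, c⟩ h
    simp only [mem_sigma, mem_filter, mem_product, mem_range, mem_Ico] at h
    simp only [show 2 * a + (σ - 2 * a) = σ by omega]

theorem card_same_diff_triples (ℓ : ℕ) :
    ((pairs ℓ ×ˢ pairs ℓ ×ˢ pairs ℓ).filter fun t =>
          (t.1.2 = t.2.1.2 ∧ t.1.2 = t.2.2.2) ∧
            (t.1.1 ≠ t.2.1.1 ∧ t.1.1 ≠ t.2.1.1 + t.1.2 ∧ t.2.1.1 ≠ t.1.1 + t.1.2) ∧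
            (t.1.1 ≠ t.2.2.1 ∧ t.1.1 ≠ t.2.2.1 + t.1.2 ∧ t.2.2.1 ≠ t.1.1 + t.1.2) ∧
            (t.2.1.1 ≠ t.2.2.1 ∧ t.2.1.1 ≠ t.2.2.1 + t.1.2 ∧
              t.2.2.1 ≠ t.2.1.1 + t.1.2)).card
    = ∑ s ∈ range ℓ, ((range (ℓ - (s + 1)) ×ˢ range (ℓ - (s + 1)) ×ˢ
        range (ℓ - (s + 1))).filter fun t =>
          (t.1 ≠ t.2.1 ∧ t.1 ≠ t.2.1 + (s + 1) ∧ t.2.1 ≠ t.1 + (s + 1)) ∧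
          (t.1 ≠ t.2.2 ∧ t.1 ≠ t.2.2 + (s + 1) ∧ t.2.2 ≠ t.1 + (s + 1)) ∧
          (t.2.1 ≠ t.2.2 ∧ t.2.1 ≠ t.2.2 + (s + 1) ∧ t.2.2 ≠ t.2.1 + (s + 1))).card := by
  rw [← card_sigma]
  refine card_bij' (fun t _ => ⟨t.1.2 - 1, t.1.1, t.2.1.1, t.2.2.1⟩)
    (fun x _ => ((x.2.1, x.1 + 1), (x.2.2.1, x.1 + 1), (x.2.2.2, x.1 + 1))) ?_ ?_ ?_ ?_
  · rintro ⟨⟨a, d⟩, ⟨b, e⟩, ⟨c, g⟩⟩ h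
    simp only [mem_filter, mem_product, mem_pairs] at h
    simp only [mem_sigma, mem_filter, mem_product, mem_range,
      show d - 1 + 1 = d by omega]
    refine ⟨by omega, by omega, h.2.2⟩
  · rintro ⟨s, a, b, c⟩ h
    simp only [mem_sigma, mem_filter, mem_product, mem_range] at h
    simp only [mem_filter, mem_product, mem_pairs]
    exact ⟨by omega, ⟨trivial, trivial⟩, h.2.2⟩
  · rintro ⟨⟨a, d⟩, ⟨b, e⟩, ⟨c, g⟩⟩ h
    simp only [mem_filter, mem_product, mem_pairs] at h
    simp only [Prod.mk.injEq, true_and]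
    omega
  · rintro ⟨s, a, b, c⟩ h
    rfl

/-- The indicator that two numbers coincide or differ by `δ`. -/
noncomputable def near (δ a b : ℕ) : ℝ := if a ≠ b ∧ a ≠ b + δ ∧ b ≠ a + δ then 0 else 1

theorem near_comm (δ a b : ℕ) : near δ a b = near δ b a := by
  unfold near
  congr 1
  rw [eq_iff_iff]
  constructor <;> exact fun h => ⟨h.1.symm, h.2.2, h.2.1⟩

theorem sum_near {δ n a : ℕ} (hδ : 0 < δ) (ha : a < n) :
    ∑ b ∈ range n, near δ a b = 1 + (if δ ≤ a then 1 else 0) + if a + δ < n then 1 else 0 := by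
  -- For `a < δ` the truncated `a - δ` is 0, a spurious neighbour; the inner condition `δ ≤ a`
  -- removes it.
  have h : ∀ b ∈ range n, near δ a b = (if b = a then (1 : ℝ) else 0)
      + (if b = a - δ then (if δ ≤ a then (1 : ℝ) else 0) else 0)
      + if b = a + δ then (1 : ℝ) else 0 := by
    intro b _
    unfold near
    split_ifs <;> first | omega | simp
  rw [sum_congr rfl h, sum_add_distrib, sum_add_distrib, sum_ite_eq', sum_ite_eq', sum_ite_eq']
  simp only [mem_range, ha, if_true]
  rw [if_pos (by omega)]

theorem sum_range_ite_le (δ n : ℕ) :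
    ∑ a ∈ range n, (if δ ≤ a then (1 : ℝ) else 0) = (n - δ : ℕ) := by
  rw [sum_boole, ← Nat.card_Ico]
  congr 2
  ext x
  simp only [mem_filter, mem_range, mem_Ico]
  omega

theorem sum_range_ite_add_lt (δ n : ℕ) :
    ∑ a ∈ range n, (if a + δ < n then (1 : ℝ) else 0) = (n - δ : ℕ) := by
  rw [sum_boole, ← card_range (n - δ)]
  congr 2
  ext x
  simp only [mem_filter, mem_range]
  omega

theorem sum_range_ite_le_and_add_lt (δ n : ℕ) :
    ∑ a ∈ range n, (if δ ≤ a ∧ a + δ < n then (1 : ℝ) else 0) = (n - 2 * δ : ℕ) := by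
  rw [sum_boole, show n - 2 * δ = n - δ - δ by omega, ← Nat.card_Ico]
  congr 2
  ext x
  simp only [mem_filter, mem_range, mem_Ico]
  omega

theorem sum_sum_near {δ : ℕ} (hδ : 0 < δ) (n : ℕ) :
    ∑ a ∈ range n, ∑ b ∈ range n, near δ a b = n + 2 * (n - δ : ℕ) := by
  rw [sum_congr rfl fun a ha => sum_near hδ (mem_range.1 ha), sum_add_distrib, sum_add_distrib,
    sum_range_ite_le, sum_range_ite_add_lt, sum_const, card_range, nsmul_eq_mul]
  ring

theorem sum_sum_near_sq {δ : ℕ} (hδ : 0 < δ) (n : ℕ) :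
    ∑ a ∈ range n, (∑ b ∈ range n, near δ a b) ^ 2
      = n + 6 * (n - δ : ℕ) + 2 * (n - 2 * δ : ℕ) := by
  have h : ∀ a ∈ range n, (∑ b ∈ range n, near δ a b) ^ 2
      = 1 + 3 * (if δ ≤ a then (1 : ℝ) else 0) + 3 * (if a + δ < n then (1 : ℝ) else 0)
        + 2 * (if δ ≤ a ∧ a + δ < n then (1 : ℝ) else 0) := by
    intro a ha
    rw [sum_near hδ (mem_range.1 ha)]
    by_cases h1 : δ ≤ a <;> by_cases h2 : a + δ < n <;> simp [h1, h2] <;> norm_num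
  rw [sum_congr rfl h, sum_add_distrib, sum_add_distrib, sum_add_distrib, ← mul_sum, ← mul_sum,
    ← mul_sum, sum_range_ite_le, sum_range_ite_add_lt, sum_range_ite_le_and_add_lt, sum_const,
    card_range, nsmul_eq_mul]
  ring

/-- Three distinct numbers cannot be pairwise at distance `δ`, since the outer two would be `2 * δ`
apart. So two of them coincide; the case of all three equal is counted three times, hence the
correction by 2. -/
theorem near_mul_near_mul_near {δ : ℕ} (hδ : 0 < δ) (a b c : ℕ) :
    near δ a b * near δ a c * near δ b c
      = (if a = b then near δ a c else 0) + (if a = c then near δ a b else 0)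
        + (if b = c then near δ a b else 0) - 2 * (if a = b then if a = c then 1 else 0 else 0) := by
  have hself : ∀ x, near δ x x = 1 := fun x => by simp [near]
  have hsq : ∀ x y, near δ x y * near δ x y = near δ x y := fun x y => by
    unfold near; split_ifs <;> simp
  by_cases hab : a = b
  · subst hab
    by_cases hac : a = c
    · subst hac
      simp [hself]
      norm_num
    · simp [hself, hac, hsq]
  · by_cases hac : a = c
    · subst hac
      simp [hself, hab, Ne.symm hab, near_comm δ b a, hsq]
    · by_cases hbc : b = c
      · subst hbc
        simp [hself, hab, hsq]
      · simp only [hab, hac, hbc, if_false]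
        unfold near
        split_ifs <;> first | omega | simp

theorem sum_near_mul_near_mul_near {δ : ℕ} (hδ : 0 < δ) (n : ℕ) :
    ∑ a ∈ range n, ∑ b ∈ range n, ∑ c ∈ range n, near δ a b * near δ a c * near δ b c
      = n + 6 * (n - δ : ℕ) := by
  have h1 : ∑ a ∈ range n, ∑ b ∈ range n, ∑ c ∈ range n, (if a = b then near δ a c else 0)
      = n + 2 * (n - δ : ℕ) := by
    rw [← sum_sum_near hδ n]
    refine sum_congr rfl fun a ha => ?_
    rw [sum_comm]
    refine sum_congr rfl fun c _ => ?_
    rw [sum_ite_eq, if_pos ha]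
  have h2 : ∑ a ∈ range n, ∑ b ∈ range n, ∑ c ∈ range n, (if a = c then near δ a b else 0)
      = n + 2 * (n - δ : ℕ) := by
    rw [← sum_sum_near hδ n]
    refine sum_congr rfl fun a ha => sum_congr rfl fun b _ => ?_
    rw [sum_ite_eq, if_pos ha]
  have h3 : ∑ a ∈ range n, ∑ b ∈ range n, ∑ c ∈ range n, (if b = c then near δ a b else 0)
      = n + 2 * (n - δ : ℕ) := by
    rw [← sum_sum_near hδ n]
    refine sum_congr rfl fun a _ => sum_congr rfl fun b hb => ?_
    rw [sum_ite_eq, if_pos hb]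
  have h4 : ∑ a ∈ range n, ∑ b ∈ range n, ∑ c ∈ range n,
      (if a = b then if a = c then (1 : ℝ) else 0 else 0) = n := by
    have : ∀ a ∈ range n, ∑ b ∈ range n, ∑ c ∈ range n,
        (if a = b then if a = c then (1 : ℝ) else 0 else 0) = 1 := by
      intro a ha
      rw [sum_comm, sum_congr rfl fun c _ => by rw [sum_ite_eq, if_pos ha], sum_ite_eq, if_pos ha]
    rw [sum_congr rfl this]
    simp
  simp_rw [near_mul_near_mul_near hδ, sum_sub_distrib, sum_add_distrib, ← mul_sum]
  rw [h1, h2, h3, h4]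
  ring

theorem boole_and_and (p q r : Prop) [Decidable p] [Decidable q] [Decidable r] :
    (if p ∧ q ∧ r then (1 : ℝ) else 0)
      = 1 - (if p then 0 else 1) - (if q then 0 else 1) - (if r then 0 else 1)
        + (if p then 0 else 1) * (if q then 0 else 1) + (if p then 0 else 1) * (if r then 0 else 1)
        + (if q then 0 else 1) * (if r then 0 else 1)
        - (if p then 0 else 1) * (if q then 0 else 1) * (if r then 0 else 1) := by
  by_cases hp : p <;> by_cases hq : q <;> by_cases hr : r <;> simp [hp, hq, hr]

/-- Inclusion–exclusion over the three events that two of the numbers are near. Each product of two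
indicators has a shared index, so its sum is the sum of squared neighbour counts. -/
theorem card_far_triples {δ : ℕ} (hδ : 0 < δ) (n : ℕ) :
    (((range n ×ˢ range n ×ˢ range n).filter fun t =>
          (t.1 ≠ t.2.1 ∧ t.1 ≠ t.2.1 + δ ∧ t.2.1 ≠ t.1 + δ) ∧
          (t.1 ≠ t.2.2 ∧ t.1 ≠ t.2.2 + δ ∧ t.2.2 ≠ t.1 + δ) ∧
          (t.2.1 ≠ t.2.2 ∧ t.2.1 ≠ t.2.2 + δ ∧ t.2.2 ≠ t.2.1 + δ)).card : ℝ)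
      = n * (n - 1) * (n - 2) - 6 * (n - δ : ℕ) * (n - 2) + 6 * (n - 2 * δ : ℕ) := by
  rw [← sum_boole, sum_product]
  simp_rw [sum_product]
  have h : ∀ a b c : ℕ,
      (if (a ≠ b ∧ a ≠ b + δ ∧ b ≠ a + δ) ∧ (a ≠ c ∧ a ≠ c + δ ∧ c ≠ a + δ) ∧
        (b ≠ c ∧ b ≠ c + δ ∧ c ≠ b + δ) then (1 : ℝ) else 0)
      = 1 - near δ a b - near δ a c - near δ b c + near δ a b * near δ a c
        + near δ b a * near δ b c + near δ c a * near δ c b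
        - near δ a b * near δ a c * near δ b c := by
    intro a b c
    rw [near_comm δ b a, near_comm δ c a, near_comm δ c b]
    unfold near
    exact boole_and_and _ _ _
  simp_rw [h, sum_sub_distrib, sum_add_distrib, sum_sub_distrib]
  have hsq : ∑ a ∈ range n, ∑ b ∈ range n, ∑ c ∈ range n, near δ a b * near δ a c
      = n + 6 * (n - δ : ℕ) + 2 * (n - 2 * δ : ℕ) := by
    rw [← sum_sum_near_sq hδ]
    refine sum_congr rfl fun a _ => ?_
    rw [sq, sum_mul_sum]
  have hsq2 : ∑ a ∈ range n, ∑ b ∈ range n, ∑ c ∈ range n, near δ b a * near δ b c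
      = n + 6 * (n - δ : ℕ) + 2 * (n - 2 * δ : ℕ) := by
    rw [sum_comm, ← hsq]
  have hsq3 : ∑ a ∈ range n, ∑ b ∈ range n, ∑ c ∈ range n, near δ c a * near δ c b
      = n + 6 * (n - δ : ℕ) + 2 * (n - 2 * δ : ℕ) := by
    rw [← hsq, sum_congr rfl fun a _ => sum_comm, sum_comm]
  rw [hsq, hsq2, hsq3, sum_near_mul_near_mul_near hδ]
  have e1 : ∑ a ∈ range n, ∑ b ∈ range n, ∑ c ∈ range n, near δ a b
      = n * (n + 2 * (n - δ : ℕ)) := by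
    rw [← sum_sum_near hδ, mul_sum]
    refine sum_congr rfl fun a _ => ?_
    rw [mul_sum]
    simp
  have e2 : ∑ a ∈ range n, ∑ b ∈ range n, ∑ c ∈ range n, near δ a c
      = n * (n + 2 * (n - δ : ℕ)) := by
    rw [← e1]
    exact sum_congr rfl fun a _ => sum_comm
  have e3 : ∑ a ∈ range n, ∑ b ∈ range n, ∑ c ∈ range n, near δ b c
      = n * (n + 2 * (n - δ : ℕ)) := by
    rw [← sum_sum_near hδ, sum_const, card_range, nsmul_eq_mul]
  rw [e1, e2, e3]
  simp only [sum_const, card_range, nsmul_eq_mul, mul_one]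
  ring

theorem card_far_pairs {δ : ℕ} (hδ : 0 < δ) (n : ℕ) :
    (((range n ×ˢ range n).filter fun t =>
          t.1 ≠ t.2 ∧ t.1 ≠ t.2 + δ ∧ t.2 ≠ t.1 + δ).card : ℝ)
      = n * (n - 1) - 2 * (n - δ : ℕ) := by
  rw [← sum_boole, sum_product]
  have h : ∀ a b : ℕ, (if a ≠ b ∧ a ≠ b + δ ∧ b ≠ a + δ then (1 : ℝ) else 0)
      = 1 - near δ a b := by
    intro a b
    unfold near
    split_ifs <;> norm_num
  simp_rw [h, sum_sub_distrib]
  rw [sum_sum_near hδ]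
  simp only [sum_const, card_range, nsmul_eq_mul, mul_one]
  ring

theorem card_symmDiffPairs_quads_eq_sum (ℓ : ℕ) :
    ((symmDiffPairs (quads ℓ) (quads ℓ) (quads ℓ)).card : ℝ)
      = ∑ σ ∈ range (2 * ℓ), (((σ + 1) / 2 - (σ + 1 - ℓ) : ℕ) : ℝ)
          * (((σ + 1) / 2 - (σ + 1 - ℓ) : ℕ) - 1) * (((σ + 1) / 2 - (σ + 1 - ℓ) : ℕ) - 2)
      + ∑ s ∈ range ℓ, (((ℓ - (s + 1) : ℕ) : ℝ) * ((ℓ - (s + 1) : ℕ) - 1)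
          * ((ℓ - (s + 1) : ℕ) - 2)
          - 6 * (ℓ - 2 * (s + 1) : ℕ) * ((ℓ - (s + 1) : ℕ) - 2) + 6 * (ℓ - 3 * (s + 1) : ℕ)) := by
  rw [card_symmDiffPairs_quads, card_same_sum_triples, card_same_diff_triples, Nat.cast_add,
    Nat.cast_sum, Nat.cast_sum]
  congr 1
  · refine sum_congr rfl fun σ _ => ?_
    rw [card_distinct_triples, Nat.card_Ico]
  · refine sum_congr rfl fun s _ => ?_
    rw [card_far_triples (Nat.succ_pos s), show ℓ - (s + 1) - (s + 1) = ℓ - 2 * (s + 1) by omega,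
      show ℓ - (s + 1) - 2 * (s + 1) = ℓ - 3 * (s + 1) by omega]

/-! ### Triangles of two pairs and a quad -/

theorem sum_evenPairs {M : Type*} [AddCommMonoid M] (ℓ : ℕ) (g : Finset ℕ → M) :
    ∑ A ∈ evenPairs ℓ, g A
      = ∑ p ∈ (pairs ℓ).filter (fun p => p.2 % 2 = 0), g {p.1, p.1 + p.2} := by
  have h : evenPairs ℓ = (powersetCard 2 (range ℓ)).filter (· ∈ evenPairs ℓ) := by
    ext A
    rw [mem_filter, mem_powersetCard]
    exact ⟨fun h => ⟨⟨evenPairs_subset_range A h, card_of_mem_evenPairs h⟩, h⟩, fun h => h.2⟩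
  rw [h, sum_filter, sum_powersetCard_two, sum_filter]
  refine sum_congr rfl ?_
  rintro ⟨a, d⟩ hp
  rw [mem_pairs] at hp
  refine if_congr ?_ rfl rfl
  rw [pair_mem_evenPairs]
  dsimp only
  omega

theorem card_symmDiffPairs_evenPairs_quads (ℓ : ℕ) :
    (symmDiffPairs (evenPairs ℓ) (evenPairs ℓ) (quads ℓ)).card
      = (((pairs ℓ).filter (fun p => p.2 % 2 = 0) ×ˢ
          (pairs ℓ).filter (fun p => p.2 % 2 = 0)).filter fun t =>
          2 * t.1.1 + t.1.2 = 2 * t.2.1 + t.2.2 ∧ t.1.1 ≠ t.2.1).card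
      + (((pairs ℓ).filter (fun p => p.2 % 2 = 0) ×ˢ
          (pairs ℓ).filter (fun p => p.2 % 2 = 0)).filter fun t =>
          t.1.2 = t.2.2 ∧ t.1.1 ≠ t.2.1 ∧ t.1.1 ≠ t.2.1 + t.1.2 ∧ t.2.1 ≠ t.1.1 + t.1.2).card := by
  rw [symmDiffPairs_eq_filter_matched (fun _ => card_of_mem_evenPairs)
    (fun _ => card_of_mem_quads), card_filter, sum_product, sum_evenPairs]
  simp_rw [sum_evenPairs]
  rw [card_filter, card_filter, ← sum_add_distrib, sum_product]
  refine sum_congr rfl ?_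
  rintro ⟨a, d⟩ h1
  refine sum_congr rfl ?_
  rintro ⟨b, e⟩ h2
  rw [mem_filter] at h1 h2
  simp only [matched_quads_iff h1.1 h2.1]
  rw [mem_pairs] at h1 h2
  split_ifs <;> omega

/-- Ends of equal parity have an integer midpoint `τ`; the lower end `a` then satisfies `a < τ` and
`2 * τ - a < ℓ`. -/
theorem card_same_sum_evenPairs (ℓ : ℕ) :
    (((pairs ℓ).filter (fun p => p.2 % 2 = 0) ×ˢ
        (pairs ℓ).filter (fun p => p.2 % 2 = 0)).filter fun t =>
        2 * t.1.1 + t.1.2 = 2 * t.2.1 + t.2.2 ∧ t.1.1 ≠ t.2.1).card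
      = ∑ τ ∈ range ℓ, (Ico (2 * τ + 1 - ℓ) τ).offDiag.card := by
  rw [← card_sigma]
  refine card_bij' (fun t _ => ⟨t.1.1 + t.1.2 / 2, t.1.1, t.2.1⟩)
    (fun x _ => ((x.2.1, 2 * x.1 - 2 * x.2.1), (x.2.2, 2 * x.1 - 2 * x.2.2))) ?_ ?_ ?_ ?_
  · rintro ⟨⟨a, d⟩, ⟨b, e⟩⟩ h
    simp only [mem_filter, mem_product, mem_pairs] at h
    simp only [mem_sigma, mem_offDiag, mem_range, mem_Ico]
    omega
  · rintro ⟨σ, a, b⟩ h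
    simp only [mem_sigma, mem_offDiag, mem_range, mem_Ico] at h
    simp only [mem_filter, mem_product, mem_pairs]
    omega
  · rintro ⟨⟨a, d⟩, ⟨b, e⟩⟩ h
    simp only [mem_filter, mem_product, mem_pairs] at h
    simp only [Prod.mk.injEq, true_and]
    omega
  · rintro ⟨σ, a, b⟩ h
    simp only [mem_sigma, mem_offDiag, mem_range, mem_Ico] at h
    simp only [show a + (2 * σ - 2 * a) / 2 = σ by omega]

theorem card_same_diff_evenPairs (ℓ : ℕ) :
    (((pairs ℓ).filter (fun p => p.2 % 2 = 0) ×ˢ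
        (pairs ℓ).filter (fun p => p.2 % 2 = 0)).filter fun t =>
        t.1.2 = t.2.2 ∧ t.1.1 ≠ t.2.1 ∧ t.1.1 ≠ t.2.1 + t.1.2 ∧ t.2.1 ≠ t.1.1 + t.1.2).card
      = ∑ s ∈ range ℓ, ((range (ℓ - 2 * (s + 1)) ×ˢ range (ℓ - 2 * (s + 1))).filter fun t =>
          t.1 ≠ t.2 ∧ t.1 ≠ t.2 + 2 * (s + 1) ∧ t.2 ≠ t.1 + 2 * (s + 1)).card := by
  rw [← card_sigma]
  refine card_bij' (fun t _ => ⟨t.1.2 / 2 - 1, t.1.1, t.2.1⟩)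
    (fun x _ => ((x.2.1, 2 * (x.1 + 1)), (x.2.2, 2 * (x.1 + 1)))) ?_ ?_ ?_ ?_
  · rintro ⟨⟨a, d⟩, ⟨b, e⟩⟩ h
    simp only [mem_filter, mem_product, mem_pairs] at h
    simp only [mem_sigma, mem_filter, mem_product, mem_range]
    omega
  · rintro ⟨s, a, b⟩ h
    simp only [mem_sigma, mem_filter, mem_product, mem_range] at h
    simp only [mem_filter, mem_product, mem_pairs]
    refine ⟨by omega, trivial, h.2.2⟩
  · rintro ⟨⟨a, d⟩, ⟨b, e⟩⟩ h
    simp only [mem_filter, mem_product, mem_pairs] at h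
    simp only [Prod.mk.injEq, true_and]
    omega
  · rintro ⟨s, a, b⟩ h
    simp only [show 2 * (s + 1) / 2 - 1 = s by omega]

theorem cast_card_offDiag (s : Finset ℕ) : (s.offDiag.card : ℝ) = s.card * (s.card - 1) := by
  rw [offDiag_card, Nat.cast_sub (Nat.le_mul_self _)]
  push_cast
  ring

theorem card_symmDiffPairs_evenPairs_quads_eq_sum (ℓ : ℕ) :
    ((symmDiffPairs (evenPairs ℓ) (evenPairs ℓ) (quads ℓ)).card : ℝ)
      = ∑ τ ∈ range ℓ, ((τ - (2 * τ + 1 - ℓ) : ℕ) : ℝ) * ((τ - (2 * τ + 1 - ℓ) : ℕ) - 1)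
      + ∑ s ∈ range ℓ, (((ℓ - 2 * (s + 1) : ℕ) : ℝ) * ((ℓ - 2 * (s + 1) : ℕ) - 1)
          - 2 * (ℓ - 4 * (s + 1) : ℕ)) := by
  rw [card_symmDiffPairs_evenPairs_quads, card_same_sum_evenPairs, card_same_diff_evenPairs,
    Nat.cast_add, Nat.cast_sum, Nat.cast_sum]
  congr 1
  · refine sum_congr rfl fun σ _ => ?_
    rw [cast_card_offDiag, Nat.card_Ico]
  · refine sum_congr rfl fun s _ => ?_
    rw [card_far_pairs (by omega),
      show ℓ - 2 * (s + 1) - 2 * (s + 1) = ℓ - 4 * (s + 1) by omega]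

/-! ### Triangles of three pairs -/

theorem sum_range_mod_two (h : ℕ → ℝ) (ℓ : ℕ) :
    ∑ v ∈ range ℓ, h (v % 2) = ((ℓ + 1) / 2 : ℕ) * h 0 + (ℓ / 2 : ℕ) * h 1 := by
  induction ℓ with
  | zero => simp
  | succ n ih =>
    rw [sum_range_succ, ih]
    rcases Nat.mod_two_eq_zero_or_one n with h0 | h0
    · rw [h0, show (n + 1 + 1) / 2 = (n + 1) / 2 + 1 by omega, show (n + 1) / 2 = n / 2 by omega]
      push_cast
      ring
    · rw [h0, show (n + 1 + 1) / 2 = (n + 1) / 2 by omega, show (n + 1) / 2 = n / 2 + 1 by omega]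
      push_cast
      ring

theorem extensions_evenPairs_singleton {ℓ v : ℕ} (hv : v < ℓ) :
    extensions ℓ (evenPairs ℓ) {v} = ((range ℓ).filter fun w => w % 2 = v % 2).erase v := by
  ext w
  simp only [extensions, mem_filter, mem_range, mem_singleton, mem_erase, pair_mem_evenPairs]
  omega

/-- As edges, the pairs form two complete graphs, one on each parity class. A triangle amounts to an
ordered triple of distinct elements of one class: the shared vertex and the two other ends. -/
theorem card_symmDiffPairs_evenPairs (ℓ : ℕ) :
    ((symmDiffPairs (evenPairs ℓ) (evenPairs ℓ) (evenPairs ℓ)).card : ℝ)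
      = ((ℓ + 1) / 2 : ℕ) * (((ℓ + 1) / 2 : ℕ) - 1) * (((ℓ + 1) / 2 : ℕ) - 2)
      + (ℓ / 2 : ℕ) * ((ℓ / 2 : ℕ) - 1) * ((ℓ / 2 : ℕ) - 2) := by
  rw [card_symmDiffPairs_eq_sum_offDiag (ℓ := ℓ) (k := 1) evenPairs_subset_range
    (fun _ => card_of_mem_evenPairs) fun _ => card_of_mem_evenPairs, powersetCard_one, sum_map,
    Nat.cast_sum]
  · set c : ℕ → ℝ := fun r => (((range ℓ).filter fun w => w % 2 = r).card : ℝ) with hc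
    have h : ∀ v ∈ range ℓ, ((extensions ℓ (evenPairs ℓ) {v}).offDiag.card : ℝ)
        = (c (v % 2) - 1) * (c (v % 2) - 2) := by
      intro v hv
      rw [cast_card_offDiag, extensions_evenPairs_singleton (mem_range.1 hv),
        cast_card_erase_of_mem (by simpa using hv)]
      ring
    have hc0 : c 0 = ((ℓ + 1) / 2 : ℕ) := by
      have := sum_range_mod_two (fun r => if r = 0 then 1 else 0) ℓ
      rw [sum_boole] at this
      simp only [hc]
      simpa using this
    have hc1 : c 1 = (ℓ / 2 : ℕ) := by
      have := sum_range_mod_two (fun r => if r = 1 then 1 else 0) ℓ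
      rw [sum_boole] at this
      simp only [hc]
      simpa using this
    refine (sum_congr rfl h).trans ?_
    rw [sum_range_mod_two fun r => (c r - 1) * (c r - 2), hc0, hc1]
    ring
  · intro T w z hT hw hz hwz h1 h2
    obtain ⟨v, rfl⟩ := card_eq_one.1 hT
    rw [pair_mem_evenPairs] at h1 h2 ⊢
    omega

/-! ### Triangles of two quads and a pair -/

/-- The new point `w` is balanced together with one of the three given points against the other two,
which gives one candidate for each choice. The candidate `x + v` is already present when `u = v`. -/
theorem insert_mem_quads_iff {ℓ x u v w : ℕ} (ht : (x, u, v) ∈ triples ℓ) (hw : w < ℓ) :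
    (w ∉ ({x, x + u, x + u + v} : Finset ℕ) ∧ insert w {x, x + u, x + u + v} ∈ quads ℓ) ↔
      (w = x - v ∧ v ≤ x) ∨ w = x + 2 * u + v ∨ (w = x + v ∧ u ≠ v) := by
  rw [mem_triples] at ht
  simp only [mem_insert, mem_singleton, not_or]
  constructor
  · rintro ⟨h1, h2⟩
    rw [quad_mem_quads] at h2 <;> omega
  · intro h
    have h1 : ¬ w = x ∧ ¬ w = x + u ∧ ¬ w = x + u + v := by omega
    refine ⟨h1, ?_⟩
    rw [quad_mem_quads] <;> omega

theorem card_extensions_quads {ℓ x u v : ℕ} (ht : (x, u, v) ∈ triples ℓ) :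
    ((extensions ℓ (quads ℓ) {x, x + u, x + u + v}).card : ℝ)
      = (if v ≤ x then 1 else 0) + (if x + 2 * u + v < ℓ then 1 else 0)
        + if u = v then 0 else 1 := by
  unfold extensions
  rw [filter_congr fun w hw => insert_mem_quads_iff ht (mem_range.1 hw), ← sum_boole]
  rw [mem_triples] at ht
  have h : ∀ w ∈ range ℓ, (if (w = x - v ∧ v ≤ x) ∨ w = x + 2 * u + v ∨ (w = x + v ∧ u ≠ v)
      then (1 : ℝ) else 0) = (if w = x - v then (if v ≤ x then 1 else 0) else 0)
        + (if w = x + 2 * u + v then 1 else 0)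
        + if w = x + v then (if u = v then 0 else 1) else 0 := by
    intro w _
    split_ifs <;> first | omega | simp
  rw [sum_congr rfl h, sum_add_distrib, sum_add_distrib, sum_ite_eq', sum_ite_eq', sum_ite_eq']
  simp only [mem_range]
  rw [if_pos (by omega : x - v < ℓ), if_pos (by omega : x + v < ℓ)]

/-- The sum `∑ (ℓ - 2 v - u)` over positive `u` and `v`, with truncated subtraction. -/
def doubleSum (ℓ : ℕ) : ℕ :=
  ∑ s ∈ range ℓ, ∑ u ∈ range (ℓ - 2 * (s + 1)), (ℓ - 2 * (s + 1) - (u + 1))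

theorem doubleSum_eq_card (ℓ : ℕ) :
    doubleSum ℓ = ((range ℓ).sigma fun s => (range (ℓ - 2 * (s + 1))).sigma fun u =>
      range (ℓ - 2 * (s + 1) - (u + 1))).card := by
  simp only [doubleSum, card_sigma, card_range]

theorem card_filter_low (ℓ : ℕ) :
    ((triples ℓ).filter fun t => t.2.2 ≤ t.1).card = doubleSum ℓ := by
  rw [doubleSum_eq_card]
  refine card_bij' (fun t _ => ⟨t.2.2 - 1, t.2.1 - 1, t.1 - t.2.2⟩)
    (fun x _ => (x.2.2 + x.1 + 1, x.2.1 + 1, x.1 + 1)) ?_ ?_ ?_ ?_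
  · rintro ⟨a, u, v⟩ h
    simp only [mem_filter, mem_triples] at h
    simp only [mem_sigma, mem_range]
    omega
  · rintro ⟨s, u, a⟩ h
    simp only [mem_sigma, mem_range] at h
    simp only [mem_filter, mem_triples]
    omega
  · rintro ⟨a, u, v⟩ h
    simp only [mem_filter, mem_triples] at h
    simp only [Prod.mk.injEq]
    omega
  · rintro ⟨s, u, a⟩ h
    simp only [show s + 1 - 1 = s by omega, show u + 1 - 1 = u by omega,
      show a + s + 1 - (s + 1) = a by omega]

theorem card_filter_high (ℓ : ℕ) :
    ((triples ℓ).filter fun t => t.1 + 2 * t.2.1 + t.2.2 < ℓ).card = doubleSum ℓ := by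
  rw [doubleSum_eq_card]
  refine card_bij' (fun t _ => ⟨t.2.1 - 1, t.2.2 - 1, t.1⟩)
    (fun x _ => (x.2.2, x.1 + 1, x.2.1 + 1)) ?_ ?_ ?_ ?_
  · rintro ⟨a, u, v⟩ h
    simp only [mem_filter, mem_triples] at h
    simp only [mem_sigma, mem_range]
    omega
  · rintro ⟨s, u, a⟩ h
    simp only [mem_sigma, mem_range] at h
    simp only [mem_filter, mem_triples]
    omega
  · rintro ⟨a, u, v⟩ h
    simp only [mem_filter, mem_triples] at h
    simp only [Prod.mk.injEq, true_and]
    omega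
  · rintro ⟨s, u, a⟩ h
    rfl

theorem card_quads (ℓ : ℕ) : (quads ℓ).card = doubleSum ℓ := by
  rw [quads, card_image_of_injOn (parallelogram_injOn ℓ), doubleSum_eq_card]
  refine card_bij' (fun t _ => ⟨t.2.1 - 1, t.2.2 - t.2.1 - 1, t.1⟩)
    (fun x _ => (x.2.2, x.1 + 1, x.1 + x.2.1 + 2)) ?_ ?_ ?_ ?_
  · rintro ⟨a, u, v⟩ h
    simp only [mem_filter, mem_triples] at h
    simp only [mem_sigma, mem_range]
    omega
  · rintro ⟨s, u, a⟩ h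
    simp only [mem_sigma, mem_range] at h
    simp only [mem_filter, mem_triples]
    omega
  · rintro ⟨a, u, v⟩ h
    simp only [mem_filter, mem_triples] at h
    simp only [Prod.mk.injEq, true_and]
    omega
  · rintro ⟨s, u, a⟩ h
    simp only [show s + 1 - 1 = s by omega, show s + u + 2 - (s + 1) - 1 = u by omega]

theorem card_evenPairs (ℓ : ℕ) : (evenPairs ℓ).card = ∑ s ∈ range ℓ, (ℓ - 2 * (s + 1)) := by
  have h : ∑ s ∈ range ℓ, (ℓ - 2 * (s + 1))
      = ((range ℓ).sigma fun s => range (ℓ - 2 * (s + 1))).card := by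
    simp only [card_sigma, card_range]
  rw [evenPairs, card_image_of_injOn (evenPair_injOn ℓ), h]
  refine card_bij' (fun t _ => ⟨t.2.1 - 1, t.1⟩) (fun x _ => (x.2, x.1 + 1, x.1 + 1)) ?_ ?_ ?_ ?_
  · rintro ⟨a, u, v⟩ h
    simp only [mem_filter, mem_triples] at h
    simp only [mem_sigma, mem_range]
    omega
  · rintro ⟨s, a⟩ h
    simp only [mem_sigma, mem_range] at h
    simp only [mem_filter, mem_triples, and_true]
    omega
  · rintro ⟨a, u, v⟩ h
    simp only [mem_filter, mem_triples] at h
    simp only [Prod.mk.injEq, true_and]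
    omega
  · rintro ⟨s, a⟩ h
    rfl

theorem card_filter_low_eq (ℓ : ℕ) :
    ((triples ℓ).filter fun t => t.2.2 ≤ t.1 ∧ t.2.1 = t.2.2).card
      = ∑ s ∈ range ℓ, (ℓ - 3 * (s + 1)) := by
  have h : ∑ s ∈ range ℓ, (ℓ - 3 * (s + 1))
      = ((range ℓ).sigma fun s => range (ℓ - 3 * (s + 1))).card := by
    simp only [card_sigma, card_range]
  rw [h]
  refine card_bij' (fun t _ => ⟨t.2.1 - 1, t.1 - t.2.1⟩)
    (fun x _ => (x.2 + x.1 + 1, x.1 + 1, x.1 + 1)) ?_ ?_ ?_ ?_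
  · rintro ⟨a, u, v⟩ h
    simp only [mem_filter, mem_triples] at h
    simp only [mem_sigma, mem_range]
    omega
  · rintro ⟨s, a⟩ h
    simp only [mem_sigma, mem_range] at h
    simp only [mem_filter, mem_triples, and_true]
    omega
  · rintro ⟨a, u, v⟩ h
    simp only [mem_filter, mem_triples] at h
    simp only [Prod.mk.injEq]
    omega
  · rintro ⟨s, a⟩ h
    simp only [show s + 1 - 1 = s by omega, show a + s + 1 - (s + 1) = a by omega]

theorem card_filter_high_eq (ℓ : ℕ) :
    ((triples ℓ).filter fun t => t.1 + 2 * t.2.1 + t.2.2 < ℓ ∧ t.2.1 = t.2.2).card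
      = ∑ s ∈ range ℓ, (ℓ - 3 * (s + 1)) := by
  have h : ∑ s ∈ range ℓ, (ℓ - 3 * (s + 1))
      = ((range ℓ).sigma fun s => range (ℓ - 3 * (s + 1))).card := by
    simp only [card_sigma, card_range]
  rw [h]
  refine card_bij' (fun t _ => ⟨t.2.1 - 1, t.1⟩) (fun x _ => (x.2, x.1 + 1, x.1 + 1)) ?_ ?_ ?_ ?_
  · rintro ⟨a, u, v⟩ h
    simp only [mem_filter, mem_triples] at h
    simp only [mem_sigma, mem_range]
    omega
  · rintro ⟨s, a⟩ h
    simp only [mem_sigma, mem_range] at h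
    simp only [mem_filter, mem_triples, and_true]
    omega
  · rintro ⟨a, u, v⟩ h
    simp only [mem_filter, mem_triples] at h
    simp only [Prod.mk.injEq, true_and]
    omega
  · rintro ⟨s, a⟩ h
    rfl

theorem card_filter_low_high (ℓ : ℕ) :
    ((triples ℓ).filter fun t => t.2.2 ≤ t.1 ∧ t.1 + 2 * t.2.1 + t.2.2 < ℓ).card
      = ∑ s ∈ range ℓ, ∑ r ∈ range ℓ, (ℓ - 2 * (s + 1) - 2 * (r + 1)) := by
  have h : ∑ s ∈ range ℓ, ∑ r ∈ range ℓ, (ℓ - 2 * (s + 1) - 2 * (r + 1))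
      = ((range ℓ).sigma fun s => (range ℓ).sigma fun r =>
        range (ℓ - 2 * (s + 1) - 2 * (r + 1))).card := by
    simp only [card_sigma, card_range]
  rw [h]
  refine card_bij' (fun t _ => ⟨t.2.2 - 1, t.2.1 - 1, t.1 - t.2.2⟩)
    (fun x _ => (x.2.2 + x.1 + 1, x.2.1 + 1, x.1 + 1)) ?_ ?_ ?_ ?_
  · rintro ⟨a, u, v⟩ h
    simp only [mem_filter, mem_triples] at h
    simp only [mem_sigma, mem_range]
    omega
  · rintro ⟨s, u, a⟩ h
    simp only [mem_sigma, mem_range] at h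
    simp only [mem_filter, mem_triples]
    omega
  · rintro ⟨a, u, v⟩ h
    simp only [mem_filter, mem_triples] at h
    simp only [Prod.mk.injEq]
    omega
  · rintro ⟨s, u, a⟩ h
    simp only [show s + 1 - 1 = s by omega, show u + 1 - 1 = u by omega,
      show a + s + 1 - (s + 1) = a by omega]

/-- For a sum `n` of indicators, `n * (n - 1)` is twice the sum of their pairwise products; the
indicator of `¬ r` is written as one minus that of `r`. -/
theorem boole_add_mul_sub_one (p q r : Prop) [Decidable p] [Decidable q] [Decidable r] :
    ((if p then (1 : ℝ) else 0) + (if q then 1 else 0) + if r then 0 else 1)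
        * ((if p then (1 : ℝ) else 0) + (if q then 1 else 0) + (if r then 0 else 1) - 1)
      = 2 * ((if p ∧ q then 1 else 0) + (if p then 1 else 0) + (if q then 1 else 0)
        - (if p ∧ r then 1 else 0) - if q ∧ r then 1 else 0) := by
  by_cases hp : p <;> by_cases hq : q <;> by_cases hr : r <;> simp [hp, hq, hr] <;> norm_num

theorem card_symmDiffPairs_quads_evenPairs (ℓ : ℕ) :
    ((symmDiffPairs (quads ℓ) (quads ℓ) (evenPairs ℓ)).card : ℝ)
      = 2 * ((∑ s ∈ range ℓ, ∑ r ∈ range ℓ, (ℓ - 2 * (s + 1) - 2 * (r + 1)) : ℕ)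
        + 2 * (doubleSum ℓ - (∑ s ∈ range ℓ, (ℓ - 3 * (s + 1)) : ℕ))) := by
  rw [card_symmDiffPairs_eq_sum_offDiag (ℓ := ℓ) (k := 3) quads_subset_range
    (fun _ => card_of_mem_quads) fun _ => card_of_mem_evenPairs, sum_powersetCard_three,
    Nat.cast_sum]
  · have h : ∀ t ∈ triples ℓ,
        ((extensions ℓ (quads ℓ) {t.1, t.1 + t.2.1, t.1 + t.2.1 + t.2.2}).offDiag.card : ℝ)
        = 2 * ((if t.2.2 ≤ t.1 ∧ t.1 + 2 * t.2.1 + t.2.2 < ℓ then 1 else 0)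
          + (if t.2.2 ≤ t.1 then 1 else 0) + (if t.1 + 2 * t.2.1 + t.2.2 < ℓ then 1 else 0)
          - (if t.2.2 ≤ t.1 ∧ t.2.1 = t.2.2 then 1 else 0)
          - (if t.1 + 2 * t.2.1 + t.2.2 < ℓ ∧ t.2.1 = t.2.2 then 1 else 0)) := by
      rintro ⟨x, u, v⟩ ht
      rw [cast_card_offDiag, card_extensions_quads ht]
      exact boole_add_mul_sub_one _ _ _
    rw [sum_congr rfl h, ← mul_sum, sum_sub_distrib, sum_sub_distrib, sum_add_distrib,
      sum_add_distrib]
    simp only [sum_boole]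
    rw [card_filter_low_high, card_filter_low, card_filter_high, card_filter_low_eq,
      card_filter_high_eq]
    ring
  -- The candidates `x - v`, `x + v`, `x + 2 * u + v` differ by `2 * v`, `2 * u` and `2 * u + 2 *
  -- v`, so any two completions form an even pair.
  · intro T w z hT hw hz hwz h1 h2
    have hT' : T ∈ powersetCard 3 (range ℓ) :=
      mem_powersetCard.2 ⟨(subset_insert w T).trans (quads_subset_range _ h1), hT⟩
    have hwℓ := mem_range.1 (quads_subset_range _ h1 (mem_insert_self w T))
    have hzℓ := mem_range.1 (quads_subset_range _ h2 (mem_insert_self z T))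
    obtain ⟨x, u, v, ht, rfl⟩ := exists_triple_of_mem_powersetCard_three hT'
    have h3 := (insert_mem_quads_iff ht hwℓ).1 ⟨hw, h1⟩
    have h4 := (insert_mem_quads_iff ht hzℓ).1 ⟨hz, h2⟩
    rw [mem_triples] at ht
    rw [pair_mem_evenPairs]
    omega

/-! ### Closed forms of the elementary sums -/

theorem sum_range_sub_mul_add {c : ℕ} (hc : 0 < c) {h : ℕ → ℝ} (h0 : h 0 = 0) (ℓ : ℕ) :
    ∑ s ∈ range (ℓ + c), h (ℓ + c - c * (s + 1)) = h ℓ + ∑ s ∈ range ℓ, h (ℓ - c * (s + 1)) := by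
  have h1 : ∑ s ∈ range (ℓ + 1), h (ℓ + c - c * (s + 1))
      = ∑ s ∈ range (ℓ + c), h (ℓ + c - c * (s + 1)) := by
    refine sum_subset (range_subset_range.2 (by omega)) fun s _ hs => ?_
    rw [mem_range, not_lt] at hs
    have : ℓ + c ≤ c * (s + 1) := by nlinarith
    rw [Nat.sub_eq_zero_of_le this, h0]
  rw [← h1, sum_range_succ', add_comm]
  congr 1
  · congr 1
    omega
  · refine sum_congr rfl fun s _ => ?_
    congr 1
    rw [mul_add c (s + 1) 1]
    omega

/-- Truncated terms vanish by `h 0 = 0`, and the others run backwards through the progression `c * j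
+ r`. This is how the residue of the length enters every closed form. -/
theorem sum_range_sub_mul_zero_add {c : ℕ} (hc : 0 < c) {h : ℕ → ℝ} (h0 : h 0 = 0) {r : ℕ}
    (hr : r ≤ c) (k : ℕ) :
    ∑ s ∈ range (c * k + r), h (c * k + r - c * (s + 1)) = ∑ j ∈ range k, h (c * j + r) := by
  induction k with
  | zero =>
    rw [sum_range_zero]
    refine sum_eq_zero fun s _ => ?_
    rw [Nat.sub_eq_zero_of_le, h0]
    nlinarith
  | succ k ih =>
    rw [show c * (k + 1) + r = c * k + r + c by ring, sum_range_sub_mul_add hc h0, ih,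
      sum_range_succ, add_comm]

theorem sum_range_cast (n : ℕ) : ∑ i ∈ range n, (i : ℝ) = n * (n - 1) / 2 := by
  induction n with
  | zero => simp
  | succ n ih =>
    rw [sum_range_succ, ih]
    push_cast
    ring

theorem sum_range_cast_sq (n : ℕ) :
    ∑ i ∈ range n, (i : ℝ) ^ 2 = n * (n - 1) * (2 * n - 1) / 6 := by
  induction n with
  | zero => simp
  | succ n ih =>
    rw [sum_range_succ, ih]
    push_cast
    ring

theorem sum_range_descFactorial_two (n : ℕ) :
    ∑ i ∈ range n, (i : ℝ) * (i - 1) = n * (n - 1) * (n - 2) / 3 := by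
  induction n with
  | zero => simp
  | succ n ih =>
    rw [sum_range_succ, ih]
    push_cast
    ring

theorem sum_range_descFactorial_three (n : ℕ) :
    ∑ i ∈ range n, (i : ℝ) * (i - 1) * (i - 2) = n * (n - 1) * (n - 2) * (n - 3) / 4 := by
  induction n with
  | zero => simp
  | succ n ih =>
    rw [sum_range_succ, ih]
    push_cast
    ring

theorem sum_sub_two_mul_even (k : ℕ) :
    ∑ s ∈ range (2 * k), ((2 * k - 2 * (s + 1) : ℕ) : ℝ) = k * (k - 1) := by
  refine (sum_range_sub_mul_zero_add (c := 2) (h := fun m => (m : ℝ)) (by omega) (by simp)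
    (r := 0) (by omega) k).trans ?_
  simp only [add_zero, Nat.cast_mul, ← mul_sum, sum_range_cast]
  push_cast
  ring

theorem sum_sub_two_mul_odd (k : ℕ) :
    ∑ s ∈ range (2 * k + 1), ((2 * k + 1 - 2 * (s + 1) : ℕ) : ℝ) = k ^ 2 := by
  refine (sum_range_sub_mul_zero_add (c := 2) (h := fun m => (m : ℝ)) (by omega) (by simp)
    (r := 1) (by omega) k).trans ?_
  simp only [Nat.cast_add, sum_add_distrib, Nat.cast_mul, ← mul_sum, sum_range_cast, sum_const,
    card_range, nsmul_eq_mul]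
  push_cast
  ring

theorem sum_sub_two_mul_sq_even (k : ℕ) :
    ∑ s ∈ range (2 * k), ((2 * k - 2 * (s + 1) : ℕ) : ℝ) ^ 2
      = 2 * k * (k - 1) * (2 * k - 1) / 3 := by
  refine (sum_range_sub_mul_zero_add (c := 2) (h := fun m => (m : ℝ) ^ 2) (by omega) (by simp)
    (r := 0) (by omega) k).trans ?_
  simp only [add_zero, Nat.cast_mul, mul_pow, ← mul_sum, sum_range_cast_sq]
  push_cast
  ring

theorem sum_sub_two_mul_sq_odd (k : ℕ) :
    ∑ s ∈ range (2 * k + 1), ((2 * k + 1 - 2 * (s + 1) : ℕ) : ℝ) ^ 2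
      = k * (4 * k ^ 2 - 1) / 3 := by
  refine (sum_range_sub_mul_zero_add (c := 2) (h := fun m => (m : ℝ) ^ 2) (by omega) (by simp)
    (r := 1) (by omega) k).trans ?_
  have h : ∀ j ∈ range k, ((2 * j + 1 : ℕ) : ℝ) ^ 2 = 4 * (j : ℝ) ^ 2 + 4 * j + 1 := by
    intro j _
    push_cast
    ring
  rw [sum_congr rfl h, sum_add_distrib, sum_add_distrib, ← mul_sum, ← mul_sum, sum_range_cast,
    sum_range_cast_sq, sum_const, card_range, nsmul_eq_mul]
  ring

theorem sum_sub_four_mul {r : ℕ} (hr : r ≤ 4) (k : ℕ) :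
    ∑ s ∈ range (4 * k + r), ((4 * k + r - 4 * (s + 1) : ℕ) : ℝ) = 2 * k * (k - 1) + r * k := by
  refine (sum_range_sub_mul_zero_add (c := 4) (h := fun m => (m : ℝ)) (by omega) (by simp)
    hr k).trans ?_
  simp only [Nat.cast_add, sum_add_distrib, Nat.cast_mul, ← mul_sum, sum_range_cast, sum_const,
    card_range, nsmul_eq_mul]
  push_cast
  ring

theorem sum_sub_succ_descFactorial_three (ℓ : ℕ) :
    ∑ s ∈ range ℓ, ((ℓ - (s + 1) : ℕ) : ℝ) * ((ℓ - (s + 1) : ℕ) - 1) * ((ℓ - (s + 1) : ℕ) - 2)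
      = ℓ * (ℓ - 1) * (ℓ - 2) * (ℓ - 3) / 4 := by
  rw [← sum_range_descFactorial_three,
    ← sum_range_reflect (fun i : ℕ => (i : ℝ) * (i - 1) * (i - 2))]
  refine sum_congr rfl fun s _ => ?_
  rw [Nat.sub_sub, add_comm 1 s]

theorem cast_doubleSum (ℓ : ℕ) :
    (doubleSum ℓ : ℝ) = (∑ s ∈ range ℓ, ((ℓ - 2 * (s + 1) : ℕ) : ℝ) ^ 2
      - ∑ s ∈ range ℓ, ((ℓ - 2 * (s + 1) : ℕ) : ℝ)) / 2 := by
  rw [← sum_sub_distrib, sum_div, doubleSum, Nat.cast_sum]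
  refine sum_congr rfl fun s _ => ?_
  generalize ℓ - 2 * (s + 1) = m
  have h := sum_range_reflect (fun i : ℕ => (i : ℝ)) m
  rw [sum_range_cast] at h
  rw [Nat.cast_sum, sum_congr rfl fun u _ => by rw [add_comm u 1, ← Nat.sub_sub], h]
  ring

/-- With `m = ℓ - 2 * (s + 1)`, shortening the inner range to `m` drops only zeros, so the double
sum is a step-2 sum of step-2 sums. -/
theorem sum_sum_sub_eq (ℓ : ℕ) :
    ((∑ s ∈ range ℓ, ∑ r ∈ range ℓ, (ℓ - 2 * (s + 1) - 2 * (r + 1)) : ℕ) : ℝ)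
      = ∑ s ∈ range ℓ, (fun m : ℕ => ∑ r ∈ range m, ((m - 2 * (r + 1) : ℕ) : ℝ))
        (ℓ - 2 * (s + 1)) := by
  rw [Nat.cast_sum]
  refine sum_congr rfl fun s _ => ?_
  rw [Nat.cast_sum]
  symm
  refine sum_subset (range_subset_range.2 (by omega)) fun r _ hr => ?_
  rw [mem_range, not_lt] at hr
  rw [Nat.sub_eq_zero_of_le (by omega), Nat.cast_zero]

theorem sum_sum_sub_even (k : ℕ) :
    ((∑ s ∈ range (2 * k), ∑ r ∈ range (2 * k), (2 * k - 2 * (s + 1) - 2 * (r + 1)) : ℕ) : ℝ)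
      = k * (k - 1) * (k - 2) / 3 := by
  rw [sum_sum_sub_eq]
  refine (sum_range_sub_mul_zero_add (c := 2)
    (h := fun m : ℕ => ∑ r ∈ range m, ((m - 2 * (r + 1) : ℕ) : ℝ)) (by omega) (by simp)
    (r := 0) (by omega) k).trans ?_
  simp only [add_zero, sum_sub_two_mul_even, sum_range_descFactorial_two]

theorem sum_sum_sub_odd (k : ℕ) :
    ((∑ s ∈ range (2 * k + 1), ∑ r ∈ range (2 * k + 1),
      (2 * k + 1 - 2 * (s + 1) - 2 * (r + 1)) : ℕ) : ℝ) = k * (k - 1) * (2 * k - 1) / 6 := by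
  rw [sum_sum_sub_eq]
  refine (sum_range_sub_mul_zero_add (c := 2)
    (h := fun m : ℕ => ∑ r ∈ range m, ((m - 2 * (r + 1) : ℕ) : ℝ)) (by omega) (by simp)
    (r := 1) (by omega) k).trans ?_
  simp only [sum_sub_two_mul_odd, sum_range_cast_sq]

/-- With `m = ℓ - 2 * (s + 1)` not truncated, `ℓ - (s + 1)` equals `(ℓ + m) / 2`; truncated terms
vanish on both sides. -/
theorem sum_sub_two_mul_mul_eq (ℓ : ℕ) :
    ∑ s ∈ range ℓ, ((ℓ - 2 * (s + 1) : ℕ) : ℝ) * ((ℓ - (s + 1) : ℕ) - 2)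
      = (∑ s ∈ range ℓ, ((ℓ - 2 * (s + 1) : ℕ) : ℝ) ^ 2) / 2
        + ((ℓ : ℝ) / 2 - 2) * ∑ s ∈ range ℓ, ((ℓ - 2 * (s + 1) : ℕ) : ℝ) := by
  rw [sum_div, mul_sum, ← sum_add_distrib]
  refine sum_congr rfl fun s _ => ?_
  rcases le_total ℓ (2 * (s + 1)) with h | h
  · rw [Nat.sub_eq_zero_of_le h]
    simp
  · rw [Nat.cast_sub h, Nat.cast_sub (by omega : s + 1 ≤ ℓ)]
    push_cast
    ring

/-- As the midpoint moves through the range, the number of lower ends rises from 0 to `k - 1` and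
then falls back to 0. -/
theorem sum_center_even (k : ℕ) :
    ∑ τ ∈ range (2 * k), ((τ - (2 * τ + 1 - 2 * k) : ℕ) : ℝ)
      * ((τ - (2 * τ + 1 - 2 * k) : ℕ) - 1) = 2 * k * (k - 1) * (k - 2) / 3 := by
  rw [two_mul, sum_range_add]
  have h1 : ∑ τ ∈ range k, ((τ - (2 * τ + 1 - (k + k)) : ℕ) : ℝ)
      * ((τ - (2 * τ + 1 - (k + k)) : ℕ) - 1) = ∑ τ ∈ range k, (τ : ℝ) * (τ - 1) := by
    refine sum_congr rfl fun τ hτ => ?_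
    rw [mem_range] at hτ
    rw [show τ - (2 * τ + 1 - (k + k)) = τ by omega]
  have h2 : ∑ τ ∈ range k, ((k + τ - (2 * (k + τ) + 1 - (k + k)) : ℕ) : ℝ)
      * ((k + τ - (2 * (k + τ) + 1 - (k + k)) : ℕ) - 1) = ∑ τ ∈ range k, (τ : ℝ) * (τ - 1) := by
    rw [← sum_range_reflect (fun i : ℕ => (i : ℝ) * (i - 1))]
    refine sum_congr rfl fun τ hτ => ?_
    rw [show k + τ - (2 * (k + τ) + 1 - (k + k)) = k - 1 - τ by omega]
  rw [h1, h2, sum_range_descFactorial_two]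
  ring

theorem sum_center_odd (k : ℕ) :
    ∑ τ ∈ range (2 * k + 1), ((τ - (2 * τ + 1 - (2 * k + 1)) : ℕ) : ℝ)
      * ((τ - (2 * τ + 1 - (2 * k + 1)) : ℕ) - 1)
      = 2 * k * (k - 1) * (k - 2) / 3 + k * (k - 1) := by
  rw [show 2 * k + 1 = k + (k + 1) by ring, sum_range_add]
  have h1 : ∑ τ ∈ range k, ((τ - (2 * τ + 1 - (k + (k + 1))) : ℕ) : ℝ)
      * ((τ - (2 * τ + 1 - (k + (k + 1))) : ℕ) - 1) = ∑ τ ∈ range k, (τ : ℝ) * (τ - 1) := by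
    refine sum_congr rfl fun τ hτ => ?_
    rw [mem_range] at hτ
    rw [show τ - (2 * τ + 1 - (k + (k + 1))) = τ by omega]
  have h2 : ∑ τ ∈ range (k + 1), ((k + τ - (2 * (k + τ) + 1 - (k + (k + 1))) : ℕ) : ℝ)
      * ((k + τ - (2 * (k + τ) + 1 - (k + (k + 1))) : ℕ) - 1)
      = ∑ τ ∈ range (k + 1), (τ : ℝ) * (τ - 1) := by
    rw [← sum_range_reflect (fun i : ℕ => (i : ℝ) * (i - 1))]
    refine sum_congr rfl fun τ hτ => ?_
    rw [show k + τ - (2 * (k + τ) + 1 - (k + (k + 1))) = k + 1 - 1 - τ by omega]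
  rw [h1, h2, sum_range_succ, sum_range_descFactorial_two]
  ring

/-- The interval length is `(σ + 1) / 2` for `σ < ℓ`; above `ℓ` the other bound is active, and
reading backwards from the top gives `i / 2`. -/
theorem sum_same_sum_eq (g : ℕ → ℝ) (ℓ : ℕ) :
    ∑ σ ∈ range (2 * ℓ), g ((σ + 1) / 2 - (σ + 1 - ℓ))
      = ∑ i ∈ range ℓ, (g ((i + 1) / 2) + g (i / 2)) := by
  rw [two_mul, sum_range_add, sum_add_distrib]
  congr 1
  · refine sum_congr rfl fun σ hσ => ?_
    rw [mem_range] at hσ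
    rw [show (σ + 1) / 2 - (σ + 1 - ℓ) = (σ + 1) / 2 by omega]
  · rw [← sum_range_reflect (fun i => g (i / 2))]
    refine sum_congr rfl fun σ hσ => ?_
    rw [mem_range] at hσ
    congr 1
    omega

theorem sum_half_even (k : ℕ) :
    ∑ i ∈ range (2 * k), (((((i + 1) / 2 : ℕ) : ℝ) * (((i + 1) / 2 : ℕ) - 1)
        * (((i + 1) / 2 : ℕ) - 2)) + ((i / 2 : ℕ) : ℝ) * ((i / 2 : ℕ) - 1) * ((i / 2 : ℕ) - 2))
      = 3 * (k * (k - 1) * (k - 2) * (k - 3) / 4) + (k + 1) * k * (k - 1) * (k - 2) / 4 := by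
  induction k with
  | zero => simp
  | succ k ih =>
    rw [show 2 * (k + 1) = 2 * k + 1 + 1 by ring, sum_range_succ, sum_range_succ, ih,
      show (2 * k + 1 + 1) / 2 = k + 1 by omega, show (2 * k + 1) / 2 = k by omega,
      show 2 * k / 2 = k by omega]
    push_cast
    ring

theorem sum_same_sum_even (k : ℕ) :
    ∑ σ ∈ range (2 * (2 * k)), (((σ + 1) / 2 - (σ + 1 - 2 * k) : ℕ) : ℝ)
          * (((σ + 1) / 2 - (σ + 1 - 2 * k) : ℕ) - 1) * (((σ + 1) / 2 - (σ + 1 - 2 * k) : ℕ) - 2)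
      = 3 * (k * (k - 1) * (k - 2) * (k - 3) / 4) + (k + 1) * k * (k - 1) * (k - 2) / 4 :=
  (sum_same_sum_eq (fun n => (n : ℝ) * (n - 1) * (n - 2)) _).trans (sum_half_even k)

theorem sum_same_sum_odd (k : ℕ) :
    ∑ σ ∈ range (2 * (2 * k + 1)), (((σ + 1) / 2 - (σ + 1 - (2 * k + 1)) : ℕ) : ℝ)
          * (((σ + 1) / 2 - (σ + 1 - (2 * k + 1)) : ℕ) - 1)
          * (((σ + 1) / 2 - (σ + 1 - (2 * k + 1)) : ℕ) - 2)
      = 3 * (k * (k - 1) * (k - 2) * (k - 3) / 4) + (k + 1) * k * (k - 1) * (k - 2) / 4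
        + 2 * (k * (k - 1) * (k - 2)) := by
  refine (sum_same_sum_eq (fun n => (n : ℝ) * (n - 1) * (n - 2)) _).trans ?_
  rw [sum_range_succ, sum_half_even, show (2 * k + 1) / 2 = k by omega,
    show 2 * k / 2 = k by omega]
  ring

/-! ### Second and third central moments of `ssac` -/

/-- The sum of `χ` over the pairs plus twice its sum over the quads. -/
noncomputable def centeredSum (ℓ : ℕ) (f : ℤ → ℂ) : ℝ :=
  ∑ A ∈ evenPairs ℓ, chi A f + 2 * ∑ q ∈ quads ℓ, chi q f

theorem expectation_sum_chi_eq_zero (ℓ : ℕ) {F : Finset (Finset ℕ)} (hF : ∀ A ∈ F, A.card ≠ 0) :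
    expectation ℓ (fun f => ∑ A ∈ F, chi A f) = 0 := by
  rw [expectation_sum]
  refine sum_eq_zero fun A hA => ?_
  rw [expectation_chi, if_neg]
  rintro rfl
  exact hF _ hA card_empty

theorem expectation_centeredSum (ℓ : ℕ) : expectation ℓ (centeredSum ℓ) = 0 := by
  unfold centeredSum
  rw [expectation_add, expectation_const_mul, expectation_sum_chi_eq_zero,
    expectation_sum_chi_eq_zero]
  · simp
  · intro A hA
    rw [card_of_mem_quads hA]
    norm_num
  · intro A hA
    rw [card_of_mem_evenPairs hA]
    norm_num

theorem centralMoment_ssac (p ℓ : ℕ) :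
    centralMoment p ℓ ssac = 4 ^ p * expectation ℓ (fun f => centeredSum ℓ f ^ p) := by
  set c : ℝ := (ℓ : ℝ) ^ 2 + 2 * ∑ s ∈ range ℓ, ((ℓ - (s + 1) : ℕ) : ℝ)
  have h : ∀ f ∈ binarySeqs ℓ, ssac f = c + 4 * centeredSum ℓ f := fun f hf => ssac_eq hf
  have hE : expectation ℓ ssac = c := by
    rw [expectation_congr h, expectation_add ℓ (fun _ => c), expectation_const,
      expectation_const_mul, expectation_centeredSum]
    ring
  unfold centralMoment
  rw [hE, ← expectation_const_mul]
  refine expectation_congr fun f hf => ?_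
  rw [h f hf, add_sub_cancel_left, mul_pow]

theorem centralMoment_two_ssac (ℓ : ℕ) :
    centralMoment 2 ℓ ssac = 16 * ((evenPairs ℓ).card + 4 * (quads ℓ).card) := by
  have h : expectation ℓ (fun f => centeredSum ℓ f ^ 2)
      = (evenPairs ℓ).card + 4 * (quads ℓ).card := by
    have h1 : ∀ f ∈ binarySeqs ℓ, centeredSum ℓ f ^ 2
        = (∑ A ∈ evenPairs ℓ, chi A f) * (∑ A ∈ evenPairs ℓ, chi A f)
        + 4 * ((∑ A ∈ evenPairs ℓ, chi A f) * (∑ q ∈ quads ℓ, chi q f))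
        + 4 * ((∑ q ∈ quads ℓ, chi q f) * (∑ q ∈ quads ℓ, chi q f)) := by
      intro f _
      unfold centeredSum
      ring
    have h2 : evenPairs ℓ ∩ quads ℓ = ∅ := by
      rw [← disjoint_iff_inter_eq_empty, disjoint_left]
      intro A hA hA'
      have := card_of_mem_evenPairs hA
      have := card_of_mem_quads hA'
      omega
    rw [expectation_congr h1, expectation_add, expectation_add, expectation_const_mul,
      expectation_const_mul, expectation_sum_chi_mul_sum_chi _ _ evenPairs_subset_range,
      expectation_sum_chi_mul_sum_chi _ _ evenPairs_subset_range,
      expectation_sum_chi_mul_sum_chi _ _ quads_subset_range, h2, inter_self, inter_self]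
    simp
  rw [centralMoment_ssac, h]
  norm_num

theorem centralMoment_three_ssac (ℓ : ℕ) :
    centralMoment 3 ℓ ssac
      = 64 * ((symmDiffPairs (evenPairs ℓ) (evenPairs ℓ) (evenPairs ℓ)).card
        + 6 * (symmDiffPairs (evenPairs ℓ) (evenPairs ℓ) (quads ℓ)).card
        + 12 * (symmDiffPairs (quads ℓ) (quads ℓ) (evenPairs ℓ)).card
        + 8 * (symmDiffPairs (quads ℓ) (quads ℓ) (quads ℓ)).card) := by
  have h1 : ∀ f ∈ binarySeqs ℓ, centeredSum ℓ f ^ 3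
      = (∑ A ∈ evenPairs ℓ, chi A f) * (∑ A ∈ evenPairs ℓ, chi A f) * (∑ A ∈ evenPairs ℓ, chi A f)
      + 6 * ((∑ A ∈ evenPairs ℓ, chi A f) * (∑ A ∈ evenPairs ℓ, chi A f)
        * (∑ q ∈ quads ℓ, chi q f))
      + 12 * ((∑ q ∈ quads ℓ, chi q f) * (∑ q ∈ quads ℓ, chi q f)
        * (∑ A ∈ evenPairs ℓ, chi A f))
      + 8 * ((∑ q ∈ quads ℓ, chi q f) * (∑ q ∈ quads ℓ, chi q f)
        * (∑ q ∈ quads ℓ, chi q f)) := by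
    intro f _
    unfold centeredSum
    ring
  have hP := evenPairs_subset_range (ℓ := ℓ)
  have hQ := quads_subset_range (ℓ := ℓ)
  rw [centralMoment_ssac, expectation_congr h1, expectation_add, expectation_add, expectation_add,
    expectation_const_mul, expectation_const_mul, expectation_const_mul,
    expectation_sum_chi_mul_sum_chi_mul_sum_chi _ _ _ hP hP,
    expectation_sum_chi_mul_sum_chi_mul_sum_chi _ _ _ hP hP,
    expectation_sum_chi_mul_sum_chi_mul_sum_chi _ _ _ hQ hQ,
    expectation_sum_chi_mul_sum_chi_mul_sum_chi _ _ _ hQ hQ]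
  norm_num

/-- The third central moment in terms of elementary sums; the sums of `ℓ - 3 s` cancel. -/
theorem centralMoment_three_ssac_eq_sums (ℓ : ℕ) :
    centralMoment 3 ℓ ssac
      = 64 * ((((ℓ + 1) / 2 : ℕ) * (((ℓ + 1) / 2 : ℕ) - 1) * (((ℓ + 1) / 2 : ℕ) - 2)
          + (ℓ / 2 : ℕ) * ((ℓ / 2 : ℕ) - 1) * ((ℓ / 2 : ℕ) - 2))
        + 6 * (∑ τ ∈ range ℓ, ((τ - (2 * τ + 1 - ℓ) : ℕ) : ℝ) * ((τ - (2 * τ + 1 - ℓ) : ℕ) - 1)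
          + ∑ s ∈ range ℓ, ((ℓ - 2 * (s + 1) : ℕ) : ℝ) ^ 2
          - ∑ s ∈ range ℓ, ((ℓ - 2 * (s + 1) : ℕ) : ℝ)
          - 2 * ∑ s ∈ range ℓ, ((ℓ - 4 * (s + 1) : ℕ) : ℝ))
        + 24 * ((∑ s ∈ range ℓ, ∑ r ∈ range ℓ, (ℓ - 2 * (s + 1) - 2 * (r + 1)) : ℕ)
          + ∑ s ∈ range ℓ, ((ℓ - 2 * (s + 1) : ℕ) : ℝ) ^ 2
          - ∑ s ∈ range ℓ, ((ℓ - 2 * (s + 1) : ℕ) : ℝ))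
        + 8 * (∑ σ ∈ range (2 * ℓ), (((σ + 1) / 2 - (σ + 1 - ℓ) : ℕ) : ℝ)
            * (((σ + 1) / 2 - (σ + 1 - ℓ) : ℕ) - 1) * (((σ + 1) / 2 - (σ + 1 - ℓ) : ℕ) - 2)
          + ℓ * (ℓ - 1) * (ℓ - 2) * (ℓ - 3) / 4
          - 3 * ∑ s ∈ range ℓ, ((ℓ - 2 * (s + 1) : ℕ) : ℝ) ^ 2
          - (3 * ℓ - 12) * ∑ s ∈ range ℓ, ((ℓ - 2 * (s + 1) : ℕ) : ℝ))) := by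
  have h1 : ∑ s ∈ range ℓ, (((ℓ - 2 * (s + 1) : ℕ) : ℝ) * ((ℓ - 2 * (s + 1) : ℕ) - 1)
          - 2 * (ℓ - 4 * (s + 1) : ℕ))
      = ∑ s ∈ range ℓ, ((ℓ - 2 * (s + 1) : ℕ) : ℝ) ^ 2
          - ∑ s ∈ range ℓ, ((ℓ - 2 * (s + 1) : ℕ) : ℝ)
          - 2 * ∑ s ∈ range ℓ, ((ℓ - 4 * (s + 1) : ℕ) : ℝ) := by
    rw [mul_sum, ← sum_sub_distrib, ← sum_sub_distrib]
    exact sum_congr rfl fun s _ => by ring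
  have h2 : ∑ s ∈ range ℓ, (((ℓ - (s + 1) : ℕ) : ℝ) * ((ℓ - (s + 1) : ℕ) - 1)
          * ((ℓ - (s + 1) : ℕ) - 2)
          - 6 * (ℓ - 2 * (s + 1) : ℕ) * ((ℓ - (s + 1) : ℕ) - 2) + 6 * (ℓ - 3 * (s + 1) : ℕ))
      = ℓ * (ℓ - 1) * (ℓ - 2) * (ℓ - 3) / 4
        - 6 * ∑ s ∈ range ℓ, ((ℓ - 2 * (s + 1) : ℕ) : ℝ) * ((ℓ - (s + 1) : ℕ) - 2)
        + 6 * (∑ s ∈ range ℓ, (ℓ - 3 * (s + 1)) : ℕ) := by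
    rw [← sum_sub_succ_descFactorial_three, Nat.cast_sum, mul_sum, mul_sum, ← sum_sub_distrib,
      ← sum_add_distrib]
    exact sum_congr rfl fun s _ => by ring
  rw [centralMoment_three_ssac, card_symmDiffPairs_evenPairs,
    card_symmDiffPairs_evenPairs_quads_eq_sum, card_symmDiffPairs_quads_evenPairs,
    card_symmDiffPairs_quads_eq_sum, h1, h2, sum_sub_two_mul_mul_eq, cast_doubleSum]
  ring

/-- The step-4 sum is left unevaluated because it alone depends on the length modulo 4 and not
merely on its parity. -/
theorem centralMoment_three_ssac_even (k : ℕ) :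
    centralMoment 3 (2 * k) ssac
      = 64 * (2 * k * (k - 1) * (k - 2)
        + 6 * (2 * k * (k - 1) * (k - 2) / 3 + k * (k - 1) * (4 * k - 5) / 3
          - 2 * ∑ s ∈ range (2 * k), ((2 * k - 4 * (s + 1) : ℕ) : ℝ))
        + 24 * (k * (k - 1) * (k - 2) / 3 + k * (k - 1) * (4 * k - 5) / 3)
        + 8 * (3 * (k * (k - 1) * (k - 2) * (k - 3) / 4) + (k + 1) * k * (k - 1) * (k - 2) / 4
          + 2 * k * (2 * k - 1) * (2 * k - 2) * (2 * k - 3) / 4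
          - 2 * k * (k - 1) * (2 * k - 1) - (6 * k - 12) * (k * (k - 1)))) := by
  rw [centralMoment_three_ssac_eq_sums, sum_center_even, sum_sub_two_mul_sq_even,
    sum_sub_two_mul_even, sum_sum_sub_even, sum_same_sum_even,
    show (2 * k + 1) / 2 = k by omega, show 2 * k / 2 = k by omega]
  push_cast
  ring

theorem centralMoment_three_ssac_odd (k : ℕ) :
    centralMoment 3 (2 * k + 1) ssac
      = 64 * ((k + 1) * k * (k - 1) + k * (k - 1) * (k - 2)
        + 6 * (2 * k * (k - 1) * (k - 2) / 3 + k * (k - 1) + k * (4 * k ^ 2 - 1) / 3 - k ^ 2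
          - 2 * ∑ s ∈ range (2 * k + 1), ((2 * k + 1 - 4 * (s + 1) : ℕ) : ℝ))
        + 24 * (k * (k - 1) * (2 * k - 1) / 6 + k * (4 * k ^ 2 - 1) / 3 - k ^ 2)
        + 8 * (3 * (k * (k - 1) * (k - 2) * (k - 3) / 4) + (k + 1) * k * (k - 1) * (k - 2) / 4
          + 2 * (k * (k - 1) * (k - 2))
          + (2 * k + 1) * (2 * k) * (2 * k - 1) * (2 * k - 2) / 4
          - k * (4 * k ^ 2 - 1) - (6 * k - 9) * k ^ 2)) := by
  rw [centralMoment_three_ssac_eq_sums, sum_center_odd, sum_sub_two_mul_sq_odd,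
    sum_sub_two_mul_odd, sum_sum_sub_odd, sum_same_sum_odd,
    show (2 * k + 1 + 1) / 2 = k + 1 by omega, show (2 * k + 1) / 2 = k by omega]
  push_cast
  ring

theorem centralMoment_three_ssac_of_mod_four_eq_zero {ℓ : ℕ} (h : ℓ % 4 = 0) :
    centralMoment 3 ℓ ssac
      = 160 * (ℓ : ℝ) ^ 4 - 1296 * (ℓ : ℝ) ^ 3 + 3296 * (ℓ : ℝ) ^ 2 - 2496 * (ℓ : ℝ) := by
  obtain ⟨k, rfl⟩ : ∃ k, ℓ = 2 * (2 * k) := ⟨ℓ / 4, by omega⟩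
  rw [centralMoment_three_ssac_even, show 2 * (2 * k) = 4 * k + 0 by ring,
    sum_sub_four_mul (by omega)]
  push_cast
  ring

theorem centralMoment_three_ssac_of_odd {ℓ : ℕ} (h : ℓ % 2 = 1) :
    centralMoment 3 ℓ ssac
      = 160 * (ℓ : ℝ) ^ 4 - 1296 * (ℓ : ℝ) ^ 3 + 3296 * (ℓ : ℝ) ^ 2 - 2736 * (ℓ : ℝ) + 576 := by
  rcases (by omega : ℓ % 4 = 1 ∨ ℓ % 4 = 3) with h | h
  · obtain ⟨k, rfl⟩ : ∃ k, ℓ = 2 * (2 * k) + 1 := ⟨ℓ / 4, by omega⟩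
    rw [centralMoment_three_ssac_odd, show 2 * (2 * k) + 1 = 4 * k + 1 by ring,
      sum_sub_four_mul (by omega)]
    push_cast
    ring
  · obtain ⟨k, rfl⟩ : ∃ k, ℓ = 2 * (2 * k + 1) + 1 := ⟨ℓ / 4, by omega⟩
    rw [centralMoment_three_ssac_odd, show 2 * (2 * k + 1) + 1 = 4 * k + 3 by ring,
      sum_sub_four_mul (by omega)]
    push_cast
    ring

theorem centralMoment_three_ssac_of_mod_four_eq_two {ℓ : ℕ} (h : ℓ % 4 = 2) :
    centralMoment 3 ℓ ssac
      = 160 * (ℓ : ℝ) ^ 4 - 1296 * (ℓ : ℝ) ^ 3 + 3296 * (ℓ : ℝ) ^ 2 - 2496 * (ℓ : ℝ) - 384 := by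
  obtain ⟨k, rfl⟩ : ∃ k, ℓ = 2 * (2 * k + 1) := ⟨ℓ / 4, by omega⟩
  rw [centralMoment_three_ssac_even, show 2 * (2 * k + 1) = 4 * k + 2 by ring,
    sum_sub_four_mul (by omega)]
  push_cast
  ring

theorem centralMoment_two_ssac_eq_sums (ℓ : ℕ) :
    centralMoment 2 ℓ ssac = 16 * (2 * ∑ s ∈ range ℓ, ((ℓ - 2 * (s + 1) : ℕ) : ℝ) ^ 2
      - ∑ s ∈ range ℓ, ((ℓ - 2 * (s + 1) : ℕ) : ℝ)) := by
  rw [centralMoment_two_ssac, card_evenPairs, card_quads, cast_doubleSum, Nat.cast_sum]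
  ring

theorem centralMoment_two_ssac_of_even {ℓ : ℕ} (h : ℓ % 2 = 0) :
    centralMoment 2 ℓ ssac
      = 4 / 3 * (4 * (ℓ : ℝ) ^ 3 - 15 * (ℓ : ℝ) ^ 2 + 14 * (ℓ : ℝ)) := by
  obtain ⟨k, rfl⟩ : ∃ k, ℓ = 2 * k := ⟨ℓ / 2, by omega⟩
  rw [centralMoment_two_ssac_eq_sums, sum_sub_two_mul_even, sum_sub_two_mul_sq_even]
  push_cast
  ring

theorem centralMoment_two_ssac_of_odd {ℓ : ℕ} (h : ℓ % 2 = 1) :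
    centralMoment 2 ℓ ssac
      = 4 / 3 * (4 * (ℓ : ℝ) ^ 3 - 15 * (ℓ : ℝ) ^ 2 + 14 * (ℓ : ℝ) - 3) := by
  obtain ⟨k, rfl⟩ : ∃ k, ℓ = 2 * k + 1 := ⟨ℓ / 2, by omega⟩
  rw [centralMoment_two_ssac_eq_sums, sum_sub_two_mul_odd, sum_sub_two_mul_sq_odd]
  push_cast
  ring

theorem centralMoment_two_ssac_nonneg (ℓ : ℕ) : 0 ≤ centralMoment 2 ℓ ssac := by
  rw [centralMoment_two_ssac]
  positivity

theorem centralMoment_two_ssac_pos_iff {ℓ : ℕ} (hℓ : 0 < ℓ) :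
    0 < centralMoment 2 ℓ ssac ↔ 3 ≤ ℓ := by
  constructor
  · intro h
    by_contra h3
    rcases (by omega : ℓ = 1 ∨ ℓ = 2) with rfl | rfl
    · rw [centralMoment_two_ssac_of_odd (by norm_num)] at h
      norm_num at h
    · rw [centralMoment_two_ssac_of_even (by norm_num)] at h
      norm_num at h
  · intro h
    obtain ⟨n, rfl⟩ := Nat.exists_eq_add_of_le h
    have hn : (0 : ℝ) ≤ n := n.cast_nonneg
    rcases Nat.mod_two_eq_zero_or_one (3 + n) with h0 | h0
    · rw [centralMoment_two_ssac_of_even h0]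
      push_cast
      -- After the substitution `ℓ = 3 + n` all coefficients in `n` are positive.
      ring_nf
      positivity
    · rw [centralMoment_two_ssac_of_odd h0]
      push_cast
      ring_nf
      positivity

/-! ### Transfer to the demerit factor, and skewness -/

/-- On binary sequences `ADF` is `ssac / ℓ ^ 2 - 1`; the shift leaves central moments alone and the
scaling comes out to the power `p`. -/
theorem centralMoment_ADF {ℓ : ℕ} (hℓ : 0 < ℓ) (p : ℕ) :
    centralMoment p ℓ ADF = centralMoment p ℓ ssac / ((ℓ : ℝ) ^ 2) ^ p := by
  have hℓ' : (ℓ : ℝ) ≠ 0 := by exact_mod_cast hℓ.ne'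
  have h : ∀ f ∈ binarySeqs ℓ, ADF f = ((ℓ : ℝ) ^ 2)⁻¹ * ssac f + -1 := by
    intro f hf
    rw [ADF_eq hf]
    field_simp
    ring
  have hE : expectation ℓ ADF = ((ℓ : ℝ) ^ 2)⁻¹ * expectation ℓ ssac + -1 := by
    rw [expectation_congr h, expectation_add ℓ _ fun _ => -1, expectation_const,
      expectation_const_mul]
  unfold centralMoment
  rw [hE, div_eq_inv_mul, ← expectation_const_mul ℓ (((ℓ : ℝ) ^ 2) ^ p)⁻¹]
  refine expectation_congr fun f hf => ?_
  rw [h f hf, ← inv_pow ((ℓ : ℝ) ^ 2) p, ← mul_pow]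
  ring

theorem standardizedMoment_three_ADF {ℓ : ℕ} (hℓ : 0 < ℓ) :
    standardizedMoment 3 ℓ ADF = standardizedMoment 3 ℓ ssac := by
  have hℓ' : (0 : ℝ) < ℓ := by exact_mod_cast hℓ
  unfold standardizedMoment
  rw [centralMoment_ADF hℓ, centralMoment_ADF hℓ,
    Real.div_rpow (centralMoment_two_ssac_nonneg ℓ) (by positivity)]
  have h : (((ℓ : ℝ) ^ 2) ^ 2) ^ (((3 : ℕ) : ℝ) / 2) = ((ℓ : ℝ) ^ 2) ^ 3 := by
    rw [← Real.rpow_natCast ((ℓ : ℝ) ^ 2) 2, ← Real.rpow_mul (by positivity),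
      ← Real.rpow_natCast ((ℓ : ℝ) ^ 2) 3]
    norm_num
  rw [h, div_div_div_cancel_right₀ (by positivity)]

theorem four_thirds_rpow : (4 / 3 : ℝ) ^ (3 / 2 : ℝ) = 8 / (3 * √3) := by
  have h3 : √3 * √3 = (3 : ℝ) := Real.mul_self_sqrt (by norm_num)
  have h0 : (0 : ℝ) < √3 := by positivity
  have h : (4 / 3 : ℝ) = (2 / √3) ^ (2 : ℝ) := by
    rw [Real.rpow_two, div_pow, sq (√3), h3]
    norm_num
  rw [h, ← Real.rpow_mul (by positivity), show (2 : ℝ) * (3 / 2) = (3 : ℕ) by norm_num,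
    Real.rpow_natCast, div_pow, div_eq_div_iff (by positivity) (by positivity)]
  linear_combination (-8 * √3) * h3

/-- The constant is `16 / (4 / 3) ^ (3 / 2) = 6 * √3`. The case `B = 0`, which occurs for lengths 1
and 2, is included: both sides are then quotients by zero, hence 0. -/
theorem standardizedMoment_three_ssac_eq {ℓ : ℕ} {A B : ℝ} (hA : centralMoment 3 ℓ ssac = 16 * A)
    (hB : centralMoment 2 ℓ ssac = 4 / 3 * B) :
    standardizedMoment 3 ℓ ssac = 6 * √3 * A / B ^ (3 / 2 : ℝ) := by
  have hB0 : 0 ≤ B := by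
    have := centralMoment_two_ssac_nonneg ℓ
    rw [hB] at this
    linarith
  unfold standardizedMoment
  rw [hA, hB, Nat.cast_ofNat, Real.mul_rpow (by norm_num) hB0, four_thirds_rpow, ← div_div]
  congr 1
  field_simp
  ring

end DemeritFactor

open DemeritFactor in
/-- Third central moments and skewness of the sum of squares of the autocorrelations and of the
demerit factor. For `ℓ = 1` and `ℓ = 2` the variances vanish and the skewness formulas read
`0 / 0 = 0 / 0`; the variances are positive exactly for `3 ≤ ℓ`. -/
theorem mainTheorem3 :
    (∀ ℓ : ℕ,
      (ℓ ≡ 0 [MOD 4] →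
        centralMoment 3 ℓ ssac =
          160 * (ℓ : ℝ) ^ 4 - 1296 * (ℓ : ℝ) ^ 3 + 3296 * (ℓ : ℝ) ^ 2 - 2496 * (ℓ : ℝ)) ∧
      (ℓ ≡ 1 [MOD 4] ∨ ℓ ≡ 3 [MOD 4] →
        centralMoment 3 ℓ ssac =
          160 * (ℓ : ℝ) ^ 4 - 1296 * (ℓ : ℝ) ^ 3 + 3296 * (ℓ : ℝ) ^ 2 - 2736 * (ℓ : ℝ) + 576) ∧
      (ℓ ≡ 2 [MOD 4] →
        centralMoment 3 ℓ ssac =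
          160 * (ℓ : ℝ) ^ 4 - 1296 * (ℓ : ℝ) ^ 3 + 3296 * (ℓ : ℝ) ^ 2 - 2496 * (ℓ : ℝ) - 384)) ∧
    (∀ ℓ : ℕ, 0 < ℓ →
      (ℓ ≡ 0 [MOD 4] →
        centralMoment 3 ℓ ADF =
          (160 * (ℓ : ℝ) ^ 4 - 1296 * (ℓ : ℝ) ^ 3 + 3296 * (ℓ : ℝ) ^ 2 - 2496 * (ℓ : ℝ))
            / (ℓ : ℝ) ^ 6) ∧
      (ℓ ≡ 1 [MOD 4] ∨ ℓ ≡ 3 [MOD 4] →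
        centralMoment 3 ℓ ADF =
          (160 * (ℓ : ℝ) ^ 4 - 1296 * (ℓ : ℝ) ^ 3 + 3296 * (ℓ : ℝ) ^ 2 - 2736 * (ℓ : ℝ) + 576)
            / (ℓ : ℝ) ^ 6) ∧
      (ℓ ≡ 2 [MOD 4] →
        centralMoment 3 ℓ ADF =
          (160 * (ℓ : ℝ) ^ 4 - 1296 * (ℓ : ℝ) ^ 3 + 3296 * (ℓ : ℝ) ^ 2 - 2496 * (ℓ : ℝ) - 384)
            / (ℓ : ℝ) ^ 6)) ∧
    (∀ ℓ : ℕ, 0 < ℓ →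
      (0 < centralMoment 2 ℓ ADF ↔ 3 ≤ ℓ) ∧
      (0 < centralMoment 2 ℓ ssac ↔ 3 ≤ ℓ) ∧
      standardizedMoment 3 ℓ ADF = standardizedMoment 3 ℓ ssac ∧
      (ℓ ≡ 0 [MOD 4] →
        standardizedMoment 3 ℓ ADF =
          6 * √3 * (10 * (ℓ : ℝ) ^ 4 - 81 * (ℓ : ℝ) ^ 3 + 206 * (ℓ : ℝ) ^ 2 - 156 * (ℓ : ℝ))
            / (4 * (ℓ : ℝ) ^ 3 - 15 * (ℓ : ℝ) ^ 2 + 14 * (ℓ : ℝ)) ^ (3 / 2 : ℝ)) ∧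
      (ℓ ≡ 1 [MOD 4] ∨ ℓ ≡ 3 [MOD 4] →
        standardizedMoment 3 ℓ ADF =
          6 * √3 * (10 * (ℓ : ℝ) ^ 4 - 81 * (ℓ : ℝ) ^ 3 + 206 * (ℓ : ℝ) ^ 2 - 171 * (ℓ : ℝ) + 36)
            / (4 * (ℓ : ℝ) ^ 3 - 15 * (ℓ : ℝ) ^ 2 + 14 * (ℓ : ℝ) - 3) ^ (3 / 2 : ℝ)) ∧
      (ℓ ≡ 2 [MOD 4] →
        standardizedMoment 3 ℓ ADF =
          6 * √3 * (10 * (ℓ : ℝ) ^ 4 - 81 * (ℓ : ℝ) ^ 3 + 206 * (ℓ : ℝ) ^ 2 - 156 * (ℓ : ℝ) - 24)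
            / (4 * (ℓ : ℝ) ^ 3 - 15 * (ℓ : ℝ) ^ 2 + 14 * (ℓ : ℝ)) ^ (3 / 2 : ℝ))) := by
  have hodd : ∀ ℓ : ℕ, ℓ ≡ 1 [MOD 4] ∨ ℓ ≡ 3 [MOD 4] → ℓ % 2 = 1 := by
    intro ℓ h
    unfold Nat.ModEq at h
    omega
  refine ⟨fun ℓ => ⟨fun h => ?_, fun h => ?_, fun h => ?_⟩,
    fun ℓ hℓ => ⟨fun h => ?_, fun h => ?_, fun h => ?_⟩,
    fun ℓ hℓ => ⟨?_, ?_, ?_, fun h => ?_, fun h => ?_, fun h => ?_⟩⟩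
  · exact centralMoment_three_ssac_of_mod_four_eq_zero h
  · exact centralMoment_three_ssac_of_odd (hodd ℓ h)
  · exact centralMoment_three_ssac_of_mod_four_eq_two h
  · rw [centralMoment_ADF hℓ, centralMoment_three_ssac_of_mod_four_eq_zero h, ← pow_mul]
  · rw [centralMoment_ADF hℓ, centralMoment_three_ssac_of_odd (hodd ℓ h), ← pow_mul]
  · rw [centralMoment_ADF hℓ, centralMoment_three_ssac_of_mod_four_eq_two h, ← pow_mul]
  · have : (0 : ℝ) < ((ℓ : ℝ) ^ 2) ^ 2 := by positivity
    rw [centralMoment_ADF hℓ, div_pos_iff_of_pos_right this]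
    exact centralMoment_two_ssac_pos_iff hℓ
  · exact centralMoment_two_ssac_pos_iff hℓ
  · exact standardizedMoment_three_ADF hℓ
  · rw [standardizedMoment_three_ADF hℓ]
    refine standardizedMoment_three_ssac_eq ?_ ?_
    · rw [centralMoment_three_ssac_of_mod_four_eq_zero h]
      ring
    · refine centralMoment_two_ssac_of_even ?_
      unfold Nat.ModEq at h
      omega
  · rw [standardizedMoment_three_ADF hℓ]
    refine standardizedMoment_three_ssac_eq ?_ ?_
    · rw [centralMoment_three_ssac_of_odd (hodd ℓ h)]
      ring
    · exact centralMoment_two_ssac_of_odd (hodd ℓ h)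
  · rw [standardizedMoment_three_ADF hℓ]
    refine standardizedMoment_three_ssac_eq ?_ ?_
    · rw [centralMoment_three_ssac_of_mod_four_eq_two h]
      ring
    · refine centralMoment_two_ssac_of_even ?_
      unfold Nat.ModEq at h
      omega
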